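/- Let $N\ge 1$ and let $[x_k]=(x_0,x_1,\ldots,x_N)$ be a zero-mean (jointly) Gaussian sequence of random vectors in $\mathbb{R}^d$ on a probability space; its covariance may be singular. The sequence is called \emph{reciprocal} if for all $0\le j<l\le N$ the segment $(x_i)_{j<i<l}$ is conditionally independent, given $(x_j,x_l)$, of the two segments $(x_i)_{i<j}$ and $(x_i)_{i>l}$ taken together. For $c\in\{0,N\}$ and $d\times d$ matrices $G_{i,j}$, say that $[x_k]$ obeys the $CM_c$ model with parameters $G_{i,j}$ driven by $[e_k]=(e_0,\ldots,e_N)$ if $[e_k]$ is a zero-mean white Gaussian sequence in $\mathbb{R}^d$ (jointly Gaussian, $\mathrm{Cov}(e_k,e_j)=0$ for $k\neq j$) and, almost surely, $$x_k=G_{k,k-1}x_{k-1}+G_{k,c}x_c+e_k,\qquad k\in\{1,\ldots,N\}\setminus\{c\},$$ with the boundary condition $x_c=e_c$ and, if $c=N$, also $x_0=G_{0,N}x_N+e_0$. Put $G_k=\mathrm{Cov}(e_k)$, $G=\mathrm{diag}(G_0,\ldots,G_N)$, and let $\mathcal{G}$ be the (always nonsingular) block matrix for which these equations read $\mathcal{G}x=e$,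 where $x=[x_0',\ldots,x_N']'$ and $e=[e_0',\ldots,e_N']'$: its diagonal blocks are $I$, block row $i\ne c$ has in addition the block $-G_{i,i-1}$ in column $i-1$ (if $i\ge1$) and $-G_{i,c}$ in column $c$ (the two are added where they coincide, that is, for $c=0$, $i=1$, which gives $-2G_{1,0}$), and all other blocks are $0$. Let $$P=\mathcal{G}^{-1}G(\mathcal{G}')^{-1},$$ with $d\times d$ blocks $P_{i,j}$, $0\le i,j\le N$, and $P_i=P_{i,i}$. Consider the equation $$P_{k,i}=\begin{bmatrix}P_{k,j}&P_{k,l}\end{bmatrix}\begin{bmatrix}P_{j}&P_{j,l}\\P_{l,j}&P_{l}\end{bmatrix}^{+}\begin{bmatrix}P_{j,i}\\P_{l,i}\end{bmatrix},\qquad(*)$$ where $^{+}$ denotes the Moore-Penrose inverse. Then the following are equivalent: (o) $[x_k]$ is reciprocal; (i) there are matrices $G_{i,j}$ and a sequence $[e_k]$ on the same probability space such that $[x_k]$ obeys the $CM_N$ model with parameters $G_{i,j}$ driven by $[e_k]$, and $(*)$ holds for all $i,j,k,l\in\{0,\ldots,N\}$ with $l<i<j<k$; (ii) there are matrices $G_{i,j}$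 and a sequence $[e_k]$ on the same probability space such that $[x_k]$ obeys the $CM_0$ model with parameters $G_{i,j}$ driven by $[e_k]$, and $(*)$ holds for all $i,j,k,l\in\{0,\ldots,N\}$ with $i<j<k<l$. -/

import Mathlib

open MeasureTheory ProbabilityTheory Matrix

noncomputable section

namespace CMSeq

/-! ### The Moore-Penrose inverse of a real matrix -/

section MoorePenrose

variable {m n : Type*} [Fintype m] [Fintype n]

/-- The four Penrose equations: `B` is the Moore-Penrose inverse of `A`. -/
structure IsMPInverse (A : Matrix m n ℝ) (B : Matrix n m ℝ) : Prop where
  mul_mul : A * B * A = A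
  mul_mul' : B * A * B = B
  symm_left : (A * B)ᵀ = A * B
  symm_right : (B * A)ᵀ = B * A

theorem IsMPInverse.unique {A : Matrix m n ℝ} {B C : Matrix n m ℝ}
    (hB : IsMPInverse A B) (hC : IsMPInverse A C) : B = C := by
  have h1 : A * B = A * C := by
    calc A * B = (A * B)ᵀ := hB.symm_left.symm
      _ = ((A * C) * (A * B))ᵀ := by
        rw [← Matrix.mul_assoc (A * C) A B, hC.mul_mul]
      _ = (A * B) * (A * C) := by
        rw [Matrix.transpose_mul, hB.symm_left, hC.symm_left]
      _ = A * C := by rw [← Matrix.mul_assoc (A * B) A C, hB.mul_mul]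
  have h2 : B * A = C * A := by
    calc B * A = (B * A)ᵀ := hB.symm_right.symm
      _ = ((B * A) * (C * A))ᵀ := by
        rw [Matrix.mul_assoc B A (C * A), ← Matrix.mul_assoc A C A, hC.mul_mul]
      _ = (C * A) * (B * A) := by
        rw [Matrix.transpose_mul, hB.symm_right, hC.symm_right]
      _ = C * A := by rw [Matrix.mul_assoc C A (B * A), ← Matrix.mul_assoc A B A, hB.mul_mul]
  calc B = B * A * B := hB.mul_mul'.symm
    _ = C * A * B := by rw [h2]
    _ = C * (A * B) := Matrix.mul_assoc _ _ _
    _ = C * (A * C) := by rw [h1]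
    _ = C * A * C := (Matrix.mul_assoc _ _ _).symm
    _ = C := hC.mul_mul'

theorem IsMPInverse.exists (A : Matrix m n ℝ) : ∃ B : Matrix n m ℝ, IsMPInverse A B := by
  classical
  have hS : (Aᴴ * A).IsHermitian := Matrix.isHermitian_conjTranspose_mul_self A
  obtain ⟨U, D, hU, hSU⟩ : ∃ (U : Matrix n n ℝ) (D : n → ℝ), Uᵀ * U = 1 ∧
      Aᵀ * A = U * diagonal D * Uᵀ := by
    refine ⟨hS.eigenvectorUnitary, hS.eigenvalues, ?_, ?_⟩
    · simpa [Matrix.star_eq_conjTranspose] using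
        Unitary.coe_star_mul_self hS.eigenvectorUnitary
    · have := hS.spectral_theorem
      simpa [Unitary.conjStarAlgAut_apply, Matrix.star_eq_conjTranspose, Function.comp_def]
        using this
  set T : Matrix n n ℝ := U * diagonal (fun i => (D i)⁻¹) * Uᵀ with hT
  have key : ∀ a b : n → ℝ, (U * diagonal a * Uᵀ) * (U * diagonal b * Uᵀ)
      = U * diagonal (fun i => a i * b i) * Uᵀ := by
    intro a b
    calc (U * diagonal a * Uᵀ) * (U * diagonal b * Uᵀ)
        = U * diagonal a * (Uᵀ * U) * diagonal b * Uᵀ := by simp only [Matrix.mul_assoc]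
      _ = U * diagonal (fun i => a i * b i) * Uᵀ := by
        rw [hU, Matrix.mul_one, Matrix.mul_assoc U, diagonal_mul_diagonal]
  have hTt : Tᵀ = T := by
    rw [hT, Matrix.transpose_mul, Matrix.transpose_mul, Matrix.transpose_transpose,
      diagonal_transpose, Matrix.mul_assoc]
  have hTS : T * (Aᵀ * A) = U * diagonal (fun i => (D i)⁻¹ * D i) * Uᵀ := by
    rw [hSU, hT, key]
  have hSTS : (Aᵀ * A) * (T * (Aᵀ * A)) = Aᵀ * A := by
    rw [hTS, hSU, key]
    congr 3
    funext i
    by_cases h : D i = 0 <;> simp [h]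
  have hTST : T * (Aᵀ * A) * T = T := by
    rw [hTS, hT, key]
    congr 3
    funext i
    by_cases h : D i = 0 <;> simp [h]
  have hTSt : (T * (Aᵀ * A))ᵀ = T * (Aᵀ * A) := by
    rw [hTS, Matrix.transpose_mul, Matrix.transpose_mul, Matrix.transpose_transpose,
      diagonal_transpose, Matrix.mul_assoc]
  have hA : A * (T * (Aᵀ * A)) = A := by
    have h0 : Aᴴ * A * (T * (Aᵀ * A) - 1) = 0 := by
      rw [Matrix.conjTranspose_eq_transpose_of_trivial, Matrix.mul_sub, hSTS, Matrix.mul_one,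
        sub_self]
    rw [Matrix.conjTranspose_mul_self_mul_eq_zero] at h0
    rw [Matrix.mul_sub, Matrix.mul_one] at h0
    exact sub_eq_zero.mp h0
  refine ⟨T * Aᵀ, ⟨?_, ?_, ?_, ?_⟩⟩
  · rw [Matrix.mul_assoc, Matrix.mul_assoc T]
    exact hA
  · rw [Matrix.mul_assoc T Aᵀ A, ← Matrix.mul_assoc (T * (Aᵀ * A)) T, hTST]
  · rw [Matrix.transpose_mul, Matrix.transpose_mul, Matrix.transpose_transpose, hTt,
      Matrix.mul_assoc]
  · rw [Matrix.mul_assoc]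
    exact hTSt

/-- The Moore-Penrose inverse `A⁺`: the unique solution of the four Penrose equations. -/
def mpInv (A : Matrix m n ℝ) : Matrix n m ℝ :=
  Classical.choose (IsMPInverse.exists A)

theorem isMPInverse_mpInv (A : Matrix m n ℝ) : IsMPInverse A (mpInv A) :=
  Classical.choose_spec (IsMPInverse.exists A)

end MoorePenrose

/-! ### Reciprocal sequences -/

section Reciprocal

/-- The σ-algebra generated by the states `x i`, `i ∈ S`. -/
abbrev sigmaOf {Ω : Type*} {N d : ℕ} (x : Fin (N + 1) → Ω → (Fin d → ℝ)) (S : Set (Fin (N + 1))) :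
    MeasurableSpace Ω :=
  ⨆ i ∈ S, MeasurableSpace.comap (x i) inferInstance

/-- The σ-algebras `m₁` and `m₂` are conditionally independent given `m'`:
`P(A ∩ B | m') = P(A | m') P(B | m')` a.s. for all `A ∈ m₁`, `B ∈ m₂`. -/
def CondIndepGiven {Ω : Type*} [MeasurableSpace Ω] (μ : Measure Ω)
    (m' m₁ m₂ : MeasurableSpace Ω) : Prop :=
  ∀ A B : Set Ω, MeasurableSet[m₁] A → MeasurableSet[m₂] B →
    μ[(A ∩ B).indicator (fun _ => (1 : ℝ)) | m'] =ᵐ[μ]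
      μ[A.indicator (fun _ => (1 : ℝ)) | m'] * μ[B.indicator (fun _ => (1 : ℝ)) | m']

/-- `x_0, …, x_N` is reciprocal: for all `j < l`, given `x_j` and `x_l`, the segment inside
`(j, l)` is independent of the two segments outside `[j, l]` (taken together). -/
def IsReciprocal {Ω : Type*} [MeasurableSpace Ω] (μ : Measure Ω) {N d : ℕ}
    (x : Fin (N + 1) → Ω → (Fin d → ℝ)) : Prop :=
  ∀ j l : Fin (N + 1), j < l →
    CondIndepGiven μ (sigmaOf x {j, l}) (sigmaOf x (Set.Ioo j l)) (sigmaOf x (Set.Icc j l)ᶜ)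

end Reciprocal

/-! ### Zero-mean Gaussian sequences and the `CM_c` model -/

section Model

/-- A zero-mean (jointly) Gaussian sequence of random vectors in `ℝ^d`; its covariance may be
singular. -/
structure IsZMG {Ω : Type*} [MeasurableSpace Ω] (μ : Measure Ω) {N d : ℕ}
    (x : Fin (N + 1) → Ω → (Fin d → ℝ)) : Prop where
  measurable : ∀ k, Measurable (x k)
  gaussian : IsGaussianProcess x μ
  mean_zero : ∀ k a, ∫ ω, x k ω a ∂μ = 0

/-- The cross-covariance matrix `Cov(u, v)` of two random vectors. -/
def crossCov {Ω : Type*} [MeasurableSpace Ω] (μ : Measure Ω) {d : ℕ} (u v : Ω → (Fin d → ℝ)) :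
    Matrix (Fin d) (Fin d) ℝ :=
  Matrix.of fun a b => cov[fun ω => u ω a, fun ω => v ω b; μ]

/-- A zero-mean white Gaussian sequence: zero-mean Gaussian and uncorrelated in time. -/
structure IsWhiteZMG {Ω : Type*} [MeasurableSpace Ω] (μ : Measure Ω) {N d : ℕ}
    (e : Fin (N + 1) → Ω → (Fin d → ℝ)) : Prop extends IsZMG μ e where
  white : ∀ k j, k ≠ j → crossCov μ (e k) (e j) = 0

/-- The sequence `x` obeys the `CM_c` model (for `c = 0` or `c = N`) with parameters `G i j`
and driven by the zero-mean white Gaussian sequence `e`: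
`x_k = G_{k,k-1} x_{k-1} + G_{k,c} x_c + e_k` for `k ∈ [1, N] \ {c}`, with boundary condition
`x_c = e_c` and, for `c = N`, also `x_0 = G_{0,c} x_c + e_0`. All equalities are a.s. -/
structure ObeysCMModel {Ω : Type*} [MeasurableSpace Ω] (μ : Measure Ω) {N d : ℕ}
    (c : Fin (N + 1)) (G : Fin (N + 1) → Fin (N + 1) → Matrix (Fin d) (Fin d) ℝ)
    (e x : Fin (N + 1) → Ω → (Fin d → ℝ)) : Prop where
  white : IsWhiteZMG μ e
  dynamics : ∀ k : Fin N, k.succ ≠ c → ∀ᵐ ω ∂μ,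
    x k.succ ω = G k.succ k.castSucc *ᵥ x k.castSucc ω + G k.succ c *ᵥ x c ω + e k.succ ω
  boundary_c : ∀ᵐ ω ∂μ, x c ω = e c ω
  boundary_zero : c ≠ 0 → ∀ᵐ ω ∂μ, x 0 ω = G 0 c *ᵥ x c ω + e 0 ω

/-- The block matrix `𝒢` of the `CM_c` model written as `𝒢 x = e`: identity blocks on the
diagonal, and in every block row `i ≠ c` the block `-G_{i,i-1}` in column `i - 1` (if `i ≥ 1`)
and `-G_{i,c}` in column `c`; where these two positions coincide (`c = 0`, `i = 1`) they add up
to `-2 G_{1,0}`. -/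
def calG {N d : ℕ} (c : Fin (N + 1))
    (G : Fin (N + 1) → Fin (N + 1) → Matrix (Fin d) (Fin d) ℝ) :
    Matrix (Fin (N + 1) × Fin d) (Fin (N + 1) × Fin d) ℝ :=
  Matrix.comp _ _ _ _ ℝ (Matrix.of fun i j =>
    (if i = j then 1 else 0)
      - (if i ≠ c ∧ (j : ℕ) + 1 = i then G i j else 0)
      - (if i ≠ c ∧ j = c then G i c else 0))

/-- `P = 𝒢⁻¹ diag(G_0, …, G_N) (𝒢')⁻¹`, where `D k` stands for `G_k`. -/
def modelCov {N d : ℕ} (c : Fin (N + 1))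
    (G : Fin (N + 1) → Fin (N + 1) → Matrix (Fin d) (Fin d) ℝ)
    (D : Fin (N + 1) → Matrix (Fin d) (Fin d) ℝ) :
    Matrix (Fin (N + 1) × Fin d) (Fin (N + 1) × Fin d) ℝ :=
  (calG c G)⁻¹ * Matrix.comp _ _ _ _ ℝ (Matrix.diagonal D) * ((calG c G)ᵀ)⁻¹

/-- The block `P_{i,j}` of a block matrix. -/
def blk {N d : ℕ} (P : Matrix (Fin (N + 1) × Fin d) (Fin (N + 1) × Fin d) ℝ)
    (i j : Fin (N + 1)) : Matrix (Fin d) (Fin d) ℝ :=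
  Matrix.of fun a b => P (i, a) (j, b)

/-- `P_{k,i} = [P_{k,j} P_{k,l}] [[P_j, P_{j,l}]; [P_{l,j}, P_l]]⁺ [P_{j,i}; P_{l,i}]`. -/
def Factorizes {N d : ℕ} (P : Matrix (Fin (N + 1) × Fin d) (Fin (N + 1) × Fin d) ℝ)
    (i j k l : Fin (N + 1)) : Prop :=
  blk P k i =
    Matrix.fromCols (blk P k j) (blk P k l)
      * mpInv (Matrix.fromBlocks (blk P j j) (blk P j l) (blk P l j) (blk P l l))
      * Matrix.fromRows (blk P j i) (blk P l i)

end Model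

end CMSeq

end

/-! The scalar components of a zero-mean Gaussian sequence are vectors in L², and conditional
independence becomes geometry there: the residuals of one block, after projection onto the span of
the conditioning block, are orthogonal to the other block (`IsCenteredGaussian.condIndepGiven_iff`).
Projections exist whatever the rank of the covariance, so the singular case needs no separate
treatment. Orthogonality is checked pair by pair, which is why (*), an identity about single blocks,
can carry a statement about whole segments.

Since e = 𝒢x with 𝒢 invertible, P is the covariance matrix of x for every model of x
(`ObeysCMModel.modelCov_eq`). Hence (*) says that x_k and x_i are uncorrelated given x_j and x_l
(`factorizes_gramMatrix_iff`).

A CM_c model amounts to a Markov property relative to x_c. The equations make future and past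
uncorrelated given x_l and x_c (`condUncorr_of_model`); conversely, the one-step form of this
property makes the regression residuals a white driving sequence (`exists_obeysCMModel`).
Reciprocity yields the one-step property for c = 0 and c = N, and it yields (*).

For the converse with c = N, take l < j. If j = N, the Markov property at l is the claim. If j < N,
(*) separates the segment inside (l, j) from the states after j. With those states, x_N among them,
added to the conditioning, the Markov property at l separates the inside from the states before l.
`CondUncorr.contraction` joins the two. The case c = 0 uses the Markov property at the right
endpoint instead. -/

noncomputable section

namespace CMSeq

open scoped RealInnerProductSpace

/-! ### Conditional uncorrelatedness in an inner product space. -/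

section HilbertSpace

variable {ι E : Type*} [NormedAddCommGroup E] [InnerProductSpace ℝ E]

/-- The span of the members of a family of vectors whose index lies in `S`. -/
def famSpan (ξ : ι → E) (S : Set ι) : Submodule ℝ E := Submodule.span ℝ (ξ '' S)

theorem mem_famSpan {ξ : ι → E} {S : Set ι} {p : ι} (hp : p ∈ S) : ξ p ∈ famSpan ξ S :=
  Submodule.subset_span ⟨p, hp, rfl⟩

theorem famSpan_mono {ξ : ι → E} {S T : Set ι} (h : S ⊆ T) : famSpan ξ S ≤ famSpan ξ T :=
  Submodule.span_mono (Set.image_mono h)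

theorem famSpan_le {ξ : ι → E} {S : Set ι} {K : Submodule ℝ E} (h : ∀ p ∈ S, ξ p ∈ K) :
    famSpan ξ S ≤ K := by
  rw [famSpan, Submodule.span_le]
  rintro _ ⟨p, hp, rfl⟩
  exact h p hp

theorem inner_eq_zero_of_mem_famSpan {ξ : ι → E} {S : Set ι} {u v : E}
    (h : ∀ p ∈ S, ⟪u, ξ p⟫ = 0) (hv : v ∈ famSpan ξ S) : ⟪u, v⟫ = 0 := by
  have : famSpan ξ S ≤ (Submodule.span ℝ {u})ᗮ :=
    famSpan_le fun p hp => (Submodule.mem_orthogonal_singleton_iff_inner_right).2 (h p hp)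
  exact (Submodule.mem_orthogonal_singleton_iff_inner_right).1 (this hv)

theorem exists_sum_of_mem_famSpan [Fintype ι] {ξ : ι → E} {S : Set ι} {v : E}
    (hv : v ∈ famSpan ξ S) : ∃ c : ι → ℝ, (∀ p ∉ S, c p = 0) ∧ v = ∑ p, c p • ξ p := by
  classical
  induction hv using Submodule.span_induction with
  | mem x hx =>
    obtain ⟨p, hp, rfl⟩ := hx
    refine ⟨Pi.single p 1, fun q hq => ?_, ?_⟩
    · rw [Pi.single_eq_of_ne]
      rintro rfl
      exact hq hp
    · simp [Pi.single_apply]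
  | zero => exact ⟨0, by simp, by simp⟩
  | add x y _ _ hx hy =>
    obtain ⟨c, hc, rfl⟩ := hx
    obtain ⟨c', hc', rfl⟩ := hy
    exact ⟨c + c', fun p hp => by simp [hc p hp, hc' p hp], by
      simp [add_smul, Finset.sum_add_distrib]⟩
  | smul a x _ hx =>
    obtain ⟨c, hc, rfl⟩ := hx
    exact ⟨a • c, fun p hp => by simp [hc p hp], by simp [Finset.smul_sum, mul_smul]⟩

variable [Finite ι]

instance (ξ : ι → E) (S : Set ι) : FiniteDimensional ℝ (famSpan ξ S) :=
  FiniteDimensional.span_of_finite ℝ (S.toFinite.image ξ)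

/-- The residual of `ξ p` after projection onto the span of `ξ` over `S`. -/
def residual (ξ : ι → E) (S : Set ι) (p : ι) : E := ξ p - (famSpan ξ S).starProjection (ξ p)

theorem sub_residual_mem (ξ : ι → E) (S : Set ι) (p : ι) : ξ p - residual ξ S p ∈ famSpan ξ S := by
  simp [residual]

theorem inner_residual_of_mem_famSpan (ξ : ι → E) (S : Set ι) (p : ι) {v : E}
    (hv : v ∈ famSpan ξ S) : ⟪residual ξ S p, v⟫ = 0 :=
  Submodule.starProjection_inner_eq_zero _ _ hv

theorem residual_eq {ξ : ι → E} {S : Set ι} {p : ι} {r : E} (hs : ξ p - r ∈ famSpan ξ S)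
    (h : ∀ q ∈ S, ⟪r, ξ q⟫ = 0) : residual ξ S p = r := by
  rw [residual, Submodule.eq_starProjection_of_mem_of_inner_eq_zero hs, sub_sub_cancel]
  intro w hw
  rw [sub_sub_cancel]
  exact inner_eq_zero_of_mem_famSpan h hw

/-- The families `ξ|A` and `ξ|B` are uncorrelated given `ξ|S`: the residuals of `ξ|A` after
projection onto the span of `ξ|S` are orthogonal to `ξ|B`. -/
def CondUncorr (ξ : ι → E) (S A B : Set ι) : Prop :=
  ∀ p ∈ A, ∀ q ∈ B, ⟪residual ξ S p, ξ q⟫ = 0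

namespace CondUncorr

variable {ξ : ι → E} {S A B K M : Set ι}

theorem of_exists (h : ∀ p ∈ A, ∃ r, ξ p - r ∈ famSpan ξ S ∧ ∀ q ∈ S ∪ B, ⟪r, ξ q⟫ = 0) :
    CondUncorr ξ S A B := by
  intro p hp q hq
  obtain ⟨r, hr, h0⟩ := h p hp
  rw [residual_eq hr fun q hq => h0 q (Or.inl hq)]
  exact h0 q (Or.inr hq)

theorem mono (h : CondUncorr ξ S A B) {A' B' : Set ι} (hA : A' ⊆ A) (hB : B' ⊆ B) :
    CondUncorr ξ S A' B' :=
  fun p hp q hq => h p (hA hp) q (hB hq)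

/-- ξ q and its residual differ by a vector of the span over S, to which the residual of ξ p is
orthogonal. The right-hand side is symmetric in p and q, whence `symm`. -/
theorem inner_residual_residual (ξ : ι → E) (S : Set ι) (p q : ι) :
    ⟪residual ξ S p, ξ q⟫ = ⟪residual ξ S p, residual ξ S q⟫ := by
  have := inner_residual_of_mem_famSpan ξ S p (sub_residual_mem ξ S q)
  rwa [inner_sub_right, sub_eq_zero] at this

theorem symm (h : CondUncorr ξ S A B) : CondUncorr ξ S B A := by
  intro p hp q hq
  rw [inner_residual_residual, real_inner_comm, ← inner_residual_residual]
  exact h q hq p hp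

theorem inner_residual (h : CondUncorr ξ S A B) {p q : ι} (hp : p ∈ A) (hq : q ∈ S ∪ B) :
    ⟪residual ξ S p, ξ q⟫ = 0 :=
  hq.elim (fun hq => inner_residual_of_mem_famSpan ξ S p (mem_famSpan hq)) (h p hp q)

/-- The residual over S is already orthogonal to ξ over K, so enlarging the conditioning set by K
does not change it. Both `contraction` and `weak_union` reduce to this. -/
theorem residual_union (h : CondUncorr ξ S A K) {p : ι} (hp : p ∈ A) :
    residual ξ (S ∪ K) p = residual ξ S p :=
  residual_eq (famSpan_mono Set.subset_union_left (sub_residual_mem ξ S p))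
    fun _ hq => h.inner_residual hp hq

theorem contraction (h : CondUncorr ξ S A K) (h' : CondUncorr ξ (S ∪ K) A M) :
    CondUncorr ξ S A (K ∪ M) := by
  rintro p hp q (hq | hq)
  · exact h p hp q hq
  · rw [← h.residual_union hp]
    exact h' p hp q hq

theorem weak_union (h : CondUncorr ξ S A (K ∪ M)) : CondUncorr ξ (S ∪ K) A M := by
  intro p hp q hq
  rw [(h.mono subset_rfl Set.subset_union_left).residual_union hp]
  exact h p hp q (Or.inr hq)

/-- The form used for segments of indices: the sets may overlap, and T is any set between S and S ∪
B. -/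
theorem weak_union_of_subset {T : Set ι} (h : CondUncorr ξ S A B) (hST : S ⊆ T)
    (hTB : T ⊆ S ∪ B) (hMB : M ⊆ S ∪ B) : CondUncorr ξ T A M := by
  rw [← Set.union_eq_self_of_subset_left hST]
  exact weak_union (K := T) (M := M) fun p hp q hq =>
    h.inner_residual hp (Set.union_subset hTB hMB hq)

end CondUncorr

end HilbertSpace

/-! ### Conditional independence and conditional expectations. -/

section ConditionalExpectation

variable {Ω : Type*} {m m' m₁ m₂ m₃ mΩ : MeasurableSpace Ω} {μ : Measure Ω} [IsProbabilityMeasure μ]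

/-- If `R` is independent of `Z`, then conditioning a function of `(R, Z)` on `Z` amounts to
integrating `R` out. -/
theorem condExp_prod_of_indepFun {γ δ : Type*} [MeasurableSpace γ] [MeasurableSpace δ]
    {R : Ω → γ} {Z : Ω → δ} (hR : Measurable R) (hZ : Measurable Z) (h : IndepFun R Z μ)
    {f : δ × γ → ℝ} (hf : Measurable f) (hfi : Integrable (fun ω => f (Z ω, R ω)) μ) :
    μ[fun ω => f (Z ω, R ω) | MeasurableSpace.comap Z inferInstance] =ᵐ[μ]
      fun ω => ∫ r, f (Z ω, r) ∂(μ.map R) := by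
  have : IsProbabilityMeasure (μ.map R) := Measure.isProbabilityMeasure_map hR.aemeasurable
  have : IsProbabilityMeasure (μ.map Z) := Measure.isProbabilityMeasure_map hZ.aemeasurable
  have hprod : μ.map (fun ω => (Z ω, R ω)) = (μ.map Z).prod (μ.map R) :=
    (indepFun_iff_map_prod_eq_prod_map_map hZ.aemeasurable hR.aemeasurable).1 h.symm
  have hfi' : Integrable f ((μ.map Z).prod (μ.map R)) := by
    rw [← hprod]
    exact (integrable_map_measure hf.aestronglyMeasurable (hZ.prodMk hR).aemeasurable).2 hfi
  have hg : StronglyMeasurable fun z => ∫ r, f (z, r) ∂(μ.map R) :=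
    hf.stronglyMeasurable.integral_prod_right'
  have hgi : Integrable (fun ω => ∫ r, f (Z ω, r) ∂(μ.map R)) μ :=
    (integrable_map_measure hg.aestronglyMeasurable hZ.aemeasurable).1 hfi'.integral_prod_left
  refine (ae_eq_condExp_of_forall_setIntegral_eq hZ.comap_le hfi (fun _ _ _ => hgi.integrableOn)
    ?_ (hg.comp_measurable (comap_measurable Z)).aestronglyMeasurable).symm
  rintro _ ⟨s, hs, rfl⟩ _
  have h1 : ∫ ω in Z ⁻¹' s, (∫ r, f (Z ω, r) ∂(μ.map R)) ∂μ
      = ∫ z in s, (∫ r, f (z, r) ∂(μ.map R)) ∂(μ.map Z) :=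
    (setIntegral_map hs hg.aestronglyMeasurable hZ.aemeasurable).symm
  have h2 : ∫ ω in Z ⁻¹' s, f (Z ω, R ω) ∂μ
      = ∫ p in s ×ˢ Set.univ, f p ∂((μ.map Z).prod (μ.map R)) := by
    rw [← hprod, setIntegral_map (hs.prod MeasurableSet.univ) hf.aestronglyMeasurable
      (hZ.prodMk hR).aemeasurable]
    congr 2
    ext ω
    simp
  rw [h1, h2, setIntegral_prod _ hfi'.integrableOn]
  simp

/-- Conditional independence follows from the Markov property
`P(A | m' ⊔ m₂) = P(A | m')` for `A ∈ m₁`. -/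
theorem condIndepGiven_of_condExp_eq (hm₁ : m₁ ≤ mΩ)
    (hm₃ : m₃ ≤ mΩ) (h' : m' ≤ m₃) (h₂ : m₂ ≤ m₃)
    (h : ∀ A, MeasurableSet[m₁] A →
      μ[A.indicator (fun _ => (1 : ℝ)) | m₃] =ᵐ[μ] μ[A.indicator (fun _ => (1 : ℝ)) | m']) :
    CondIndepGiven μ m' m₁ m₂ := by
  intro A B hA hB
  have hAi : Integrable (A.indicator (fun _ => (1 : ℝ))) μ :=
    (integrable_const 1).indicator (hm₁ _ hA)
  have hBi : Integrable (B.indicator (fun _ => (1 : ℝ))) μ :=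
    (integrable_const 1).indicator (hm₃ _ (h₂ _ hB))
  have hBb : ∀ᵐ ω ∂μ, ‖B.indicator (fun _ => (1 : ℝ)) ω‖ ≤ 1 :=
    Filter.Eventually.of_forall fun ω => by
      by_cases hω : ω ∈ B <;> simp [hω]
  have hBA : (A ∩ B).indicator (fun _ => (1 : ℝ))
      = B.indicator (fun _ => (1 : ℝ)) * A.indicator (fun _ => (1 : ℝ)) := by
    rw [Set.inter_comm]
    exact Set.inter_indicator_one
  have hBm : StronglyMeasurable[m₃] (B.indicator (fun _ => (1 : ℝ))) :=
    stronglyMeasurable_const.indicator (h₂ _ hB)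
  -- Tower property through m₃: the indicator of B is m₃-measurable and comes out, and `h` then
  -- replaces P(A | m₃) by P(A | m').
  calc μ[(A ∩ B).indicator (fun _ => (1 : ℝ)) | m']
      =ᵐ[μ] μ[μ[(A ∩ B).indicator (fun _ => (1 : ℝ)) | m₃] | m'] :=
        (condExp_condExp_of_le h' hm₃).symm
    _ =ᵐ[μ] μ[B.indicator (fun _ => (1 : ℝ)) * μ[A.indicator (fun _ => (1 : ℝ)) | m'] | m'] := by
        refine condExp_congr_ae ?_
        rw [hBA]
        exact (condExp_stronglyMeasurable_mul_of_bound hm₃ hBm hAi 1 hBb).trans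
          ((h A hA).mono fun ω hω => by simp [hω])
    _ =ᵐ[μ] μ[μ[A.indicator (fun _ => (1 : ℝ)) | m'] * B.indicator (fun _ => (1 : ℝ)) | m'] := by
        rw [mul_comm]
    _ =ᵐ[μ] μ[A.indicator (fun _ => (1 : ℝ)) | m'] * μ[B.indicator (fun _ => (1 : ℝ)) | m'] := by
        refine condExp_mul_of_stronglyMeasurable_left stronglyMeasurable_condExp ?_ hBi
        rw [mul_comm]
        exact integrable_condExp.bdd_mul hBi.aestronglyMeasurable hBb

/-- A function whose integral vanishes over every set of `m` integrates to zero against every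
`m`-measurable function. -/
theorem integral_mul_eq_zero_of_setIntegral_eq_zero (hm : m ≤ mΩ)
    {f g : Ω → ℝ} (hf : Integrable f μ) (hg : StronglyMeasurable[m] g) (hgf : Integrable (g * f) μ)
    (h : ∀ s, MeasurableSet[m] s → ∫ ω in s, f ω ∂μ = 0) : ∫ ω, g ω * f ω ∂μ = 0 := by
  have h0 : (0 : Ω → ℝ) =ᵐ[μ] μ[f | m] :=
    ae_eq_condExp_of_forall_setIntegral_eq hm hf (fun _ _ _ => integrableOn_zero)
      (fun s hs _ => by simp [h s hs]) aestronglyMeasurable_zero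
  calc ∫ ω, g ω * f ω ∂μ = ∫ ω, (μ[g * f | m]) ω ∂μ := (integral_condExp hm).symm
    _ = ∫ _, (0 : ℝ) ∂μ := by
        refine integral_congr_ae ?_
        filter_upwards [condExp_mul_of_stronglyMeasurable_left hg hgf hf, h0] with ω h1 h2
        rw [h1, Pi.mul_apply, ← h2, Pi.zero_apply, mul_zero]
    _ = 0 := integral_zero _ _

/-- Self-adjointness of conditional expectation: by pulling out, both products have the conditional
expectation E[f | m] E[g | m]. -/
theorem integral_mul_condExp_comm (hm : m ≤ mΩ) {f g : Ω → ℝ}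
    (hf : Integrable f μ) (hg : Integrable g μ) (h1 : Integrable (μ[f | m] * g) μ)
    (h2 : Integrable (f * μ[g | m]) μ) :
    ∫ ω, (μ[f | m]) ω * g ω ∂μ = ∫ ω, f ω * (μ[g | m]) ω ∂μ := by
  calc ∫ ω, (μ[f | m]) ω * g ω ∂μ = ∫ ω, (μ[μ[f | m] * g | m]) ω ∂μ := (integral_condExp hm).symm
    _ = ∫ ω, (μ[f * μ[g | m] | m]) ω ∂μ := by
        refine integral_congr_ae ?_
        filter_upwards [condExp_mul_of_stronglyMeasurable_left stronglyMeasurable_condExp h1 hg,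
          condExp_mul_of_stronglyMeasurable_right stronglyMeasurable_condExp h2 hf] with ω h3 h4
        rw [h3, h4]
    _ = ∫ ω, f ω * (μ[g | m]) ω ∂μ := integral_condExp hm

/-- If `m₁` and `m₂` are conditionally independent given `m'`, then for square integrable `X ∈ m₁`
and `Y ∈ m₂`, the residual `X - E[X | m']` is orthogonal to `Y`. -/
theorem CondIndepGiven.integral_sub_condExp_mul (hm' : m' ≤ mΩ)
    (hm₁ : m₁ ≤ mΩ) (hm₂ : m₂ ≤ mΩ) (h : CondIndepGiven μ m' m₁ m₂) {X Y : Ω → ℝ}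
    (hX : StronglyMeasurable[m₁] X) (hY : StronglyMeasurable[m₂] Y) (hX2 : MemLp X 2 μ)
    (hY2 : MemLp Y 2 μ) : ∫ ω, Y ω * (X ω - (μ[X | m']) ω) ∂μ = 0 := by
  have hXi : Integrable X μ := hX2.integrable one_le_two
  have hr2 : MemLp (fun ω => X ω - (μ[X | m']) ω) 2 μ := hX2.sub (hX2.condExp one_le_two)
  refine integral_mul_eq_zero_of_setIntegral_eq_zero hm₂ (hr2.integrable one_le_two) hY
    (hY2.integrable_mul hr2) fun B hB => ?_
  set b : Ω → ℝ := B.indicator fun _ => (1 : ℝ) with hb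
  have hbi : Integrable b μ := (integrable_const 1).indicator (hm₂ _ hB)
  have hb2 : MemLp b 2 μ := memLp_indicator_const 2 (hm₂ _ hB) 1 (Or.inr (measure_ne_top μ B))
  have hcb2 : MemLp (μ[b | m']) 2 μ := hb2.condExp one_le_two
  have hg2 : MemLp (fun ω => b ω - (μ[b | m']) ω) 2 μ := hb2.sub hcb2
  -- Y has been reduced to the indicator b of B. Self-adjointness will move the conditioning from X
  -- to b, so that X can be reduced in the same way to the indicator of a set A, where the
  -- hypothesis applies.
  have key : ∫ ω, X ω * (b ω - (μ[b | m']) ω) ∂μ = 0 := by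
    refine integral_mul_eq_zero_of_setIntegral_eq_zero hm₁ (hg2.integrable one_le_two) hX
      (hX2.integrable_mul hg2) fun A hA => ?_
    set a : Ω → ℝ := A.indicator fun _ => (1 : ℝ) with ha
    have hai : Integrable a μ := (integrable_const 1).indicator (hm₁ _ hA)
    have ha2 : MemLp a 2 μ := memLp_indicator_const 2 (hm₁ _ hA) 1 (Or.inr (measure_ne_top μ A))
    have e1 : ∫ ω in A, (b ω - (μ[b | m']) ω) ∂μ = ∫ ω, a ω * (b ω - (μ[b | m']) ω) ∂μ := by
      rw [← integral_indicator (hm₁ _ hA)]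
      congr 1
      ext ω
      by_cases hω : ω ∈ A <;> simp [ha, hω]
    have e2 : ∫ ω, a ω * b ω ∂μ = ∫ ω, (μ[a | m']) ω * (μ[b | m']) ω ∂μ := by
      have hab : (fun ω => a ω * b ω) = (A ∩ B).indicator fun _ => (1 : ℝ) := by
        exact (Set.inter_indicator_one (M₀ := ℝ) (s := A) (t := B)).symm
      rw [hab, ← integral_condExp hm']
      exact integral_congr_ae (h A B hA hB)
    have e3 : ∫ ω, (μ[a | m']) ω * (μ[b | m']) ω ∂μ = ∫ ω, a ω * (μ[b | m']) ω ∂μ := by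
      have hcond : μ[μ[b | m'] | m'] = μ[b | m'] :=
        condExp_of_stronglyMeasurable hm' stronglyMeasurable_condExp integrable_condExp
      have := integral_mul_condExp_comm hm' hai integrable_condExp
        ((ha2.condExp one_le_two).integrable_mul hcb2)
        (by rw [hcond]; exact ha2.integrable_mul hcb2)
      rwa [hcond] at this
    have i1 : Integrable (fun ω => a ω * b ω) μ := ha2.integrable_mul hb2
    have i2 : Integrable (fun ω => a ω * (μ[b | m']) ω) μ := ha2.integrable_mul hcb2
    rw [e1]
    simp_rw [mul_sub]
    rw [integral_sub i1 i2, e2, e3, sub_self]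
  have e1 : ∫ ω in B, (X ω - (μ[X | m']) ω) ∂μ = ∫ ω, (X ω - (μ[X | m']) ω) * b ω ∂μ := by
    rw [← integral_indicator (hm₂ _ hB)]
    congr 1
    ext ω
    by_cases hω : ω ∈ B <;> simp [hb, hω]
  have i1 : Integrable (fun ω => X ω * b ω) μ := hX2.integrable_mul hb2
  have i2 : Integrable (fun ω => X ω * (μ[b | m']) ω) μ := hX2.integrable_mul hcb2
  have i3 : Integrable (fun ω => (μ[X | m']) ω * b ω) μ :=
    (hX2.condExp one_le_two).integrable_mul hb2
  rw [e1]
  simp_rw [sub_mul]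
  simp_rw [mul_sub] at key
  rw [integral_sub i1 i2] at key
  rw [integral_sub i1 i3, integral_mul_condExp_comm hm' hXi hbi i3 i2, key]

end ConditionalExpectation

/-! ### Gaussian families: conditional independence is conditional uncorrelatedness. -/

section GaussianFamily

variable {ι Ω : Type*} {mΩ : MeasurableSpace Ω} {μ : Measure Ω}

/-- A centred Gaussian family of real random variables. -/
structure IsCenteredGaussian (μ : Measure Ω) (X : ι → Ω → ℝ) : Prop where
  measurable : ∀ p, Measurable (X p)
  gaussian : IsGaussianProcess X μ
  mean_zero : ∀ p, ∫ ω, X p ω ∂μ = 0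

/-- The σ-algebra generated by the members of a family whose index lies in `S`. -/
abbrev sigmaFam (X : ι → Ω → ℝ) (S : Set ι) : MeasurableSpace Ω :=
  ⨆ p ∈ S, MeasurableSpace.comap (X p) inferInstance

theorem sigmaFam_eq_comap (X : ι → Ω → ℝ) (S : Set ι) :
    sigmaFam X S = MeasurableSpace.comap (fun ω (p : S) => X p ω) inferInstance := by
  simp only [sigmaFam, MeasurableSpace.pi, MeasurableSpace.comap_iSup, MeasurableSpace.comap_comp,
    Function.comp_def, iSup_subtype]

theorem sigmaFam_mono (X : ι → Ω → ℝ) {S T : Set ι} (h : S ⊆ T) : sigmaFam X S ≤ sigmaFam X T :=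
  biSup_mono h

namespace IsCenteredGaussian

variable {X : ι → Ω → ℝ}

theorem sigmaFam_le (hX : IsCenteredGaussian μ X) (S : Set ι) : sigmaFam X S ≤ mΩ :=
  iSup₂_le fun p _ => (hX.measurable p).comap_le

theorem memLp (hX : IsCenteredGaussian μ X) (p : ι) : MemLp (X p) 2 μ :=
  (hX.gaussian.hasGaussianLaw_eval p).memLp_two

/-- The members of the family as vectors of `L²`. -/
def toL2 (hX : IsCenteredGaussian μ X) (p : ι) : Lp ℝ 2 μ := (hX.memLp p).toLp (X p)

theorem inner_toLp {f g : Ω → ℝ} (hf : MemLp f 2 μ) (hg : MemLp g 2 μ) :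
    ⟪hf.toLp f, hg.toLp g⟫ = ∫ ω, f ω * g ω ∂μ := by
  rw [L2.inner_def]
  refine integral_congr_ae ?_
  filter_upwards [hf.coeFn_toLp, hg.coeFn_toLp] with ω h1 h2
  simp [h1, h2, mul_comm]

theorem cov_eq_integral [IsProbabilityMeasure μ] {f g : Ω → ℝ} (hf : MemLp f 2 μ) (hg : MemLp g 2 μ)
    (h0 : ∫ ω, g ω ∂μ = 0) : cov[f, g; μ] = ∫ ω, f ω * g ω ∂μ := by
  rw [covariance_eq_sub hf hg, h0, mul_zero, sub_zero]
  rfl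

theorem inner_toL2 [IsProbabilityMeasure μ] (hX : IsCenteredGaussian μ X) (p q : ι) :
    ⟪hX.toL2 p, hX.toL2 q⟫ = cov[X p, X q; μ] := by
  rw [toL2, toL2, inner_toLp, cov_eq_integral (hX.memLp p) (hX.memLp q) (hX.mean_zero q)]

variable [Fintype ι]

theorem exists_residual (hX : IsCenteredGaussian μ X) (S : Set ι) (p : ι) :
    ∃ c : ι → ℝ, (∀ q ∉ S, c q = 0) ∧
      residual hX.toL2 S p = hX.toL2 p - ∑ q, c q • hX.toL2 q := by
  obtain ⟨c, hc, h⟩ := exists_sum_of_mem_famSpan (sub_residual_mem hX.toL2 S p)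
  exact ⟨c, hc, by rw [← h, sub_sub_cancel]⟩

/-- The matrix of regression coefficients of the family on its members in `S`. -/
def regr (hX : IsCenteredGaussian μ X) (S : Set ι) (p : ι) : ι → ℝ :=
  Classical.choose (hX.exists_residual S p)

theorem residual_eq_sub_sum (hX : IsCenteredGaussian μ X) (S : Set ι) (p : ι) :
    residual hX.toL2 S p = hX.toL2 p - ∑ q, hX.regr S p q • hX.toL2 q :=
  (Classical.choose_spec (hX.exists_residual S p)).2

theorem regr_eq_zero (hX : IsCenteredGaussian μ X) {S : Set ι} (p : ι) {q : ι} (hq : q ∉ S) :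
    hX.regr S p q = 0 :=
  (Classical.choose_spec (hX.exists_residual S p)).1 q hq

/-- The residual of `X p` after regression on the members of the family in `S`. -/
def res (hX : IsCenteredGaussian μ X) (S : Set ι) (p : ι) (ω : Ω) : ℝ :=
  X p ω - ∑ q, hX.regr S p q * X q ω

theorem memLp_res (hX : IsCenteredGaussian μ X) (S : Set ι) (p : ι) : MemLp (hX.res S p) 2 μ :=
  (hX.memLp p).sub (memLp_finsetSum _ fun q _ => (hX.memLp q).const_mul _)

theorem coeFn_sum_smul_toL2 (hX : IsCenteredGaussian μ X) (c : ι → ℝ) :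
    (↑(∑ q, c q • hX.toL2 q) : Ω → ℝ) =ᵐ[μ] fun ω => ∑ q, c q * X q ω := by
  have h1 : ∀ᵐ ω ∂μ, ∀ q, hX.toL2 q ω = X q ω := ae_all_iff.2 fun q => (hX.memLp q).coeFn_toLp
  have h2 : ∀ᵐ ω ∂μ, ∀ q, (c q • hX.toL2 q) ω = c q • hX.toL2 q ω :=
    ae_all_iff.2 fun q => Lp.coeFn_smul _ _
  filter_upwards [h1, h2, Lp.coeFn_finsetSum Finset.univ fun q => c q • hX.toL2 q] with ω h3 h4 h5
  rw [h5, Finset.sum_apply]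
  simp [h3, h4]

theorem toLp_res (hX : IsCenteredGaussian μ X) (S : Set ι) (p : ι) :
    (hX.memLp_res S p).toLp _ = residual hX.toL2 S p := by
  rw [residual_eq_sub_sum]
  refine Lp.ext ?_
  filter_upwards [(hX.memLp_res S p).coeFn_toLp, (hX.memLp p).coeFn_toLp,
    hX.coeFn_sum_smul_toL2 (hX.regr S p),
    Lp.coeFn_sub (hX.toL2 p) (∑ q, hX.regr S p q • hX.toL2 q)] with ω h1 h2 h3 h4
  rw [h1, h4, Pi.sub_apply, h3, toL2, h2, res]

theorem measurable_res (hX : IsCenteredGaussian μ X) (S : Set ι) (p : ι) :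
    Measurable (hX.res S p) :=
  (hX.measurable p).sub (Finset.measurable_sum _ fun q _ => (hX.measurable q).const_mul _)

theorem integral_res_mul (hX : IsCenteredGaussian μ X) (S : Set ι) (p q : ι) :
    ∫ ω, hX.res S p ω * X q ω ∂μ = ⟪residual hX.toL2 S p, hX.toL2 q⟫ := by
  rw [← toLp_res, toL2, inner_toLp]

variable [IsProbabilityMeasure μ]

theorem integral_res (hX : IsCenteredGaussian μ X) (S : Set ι) (p : ι) :
    ∫ ω, hX.res S p ω ∂μ = 0 := by
  have hi : ∀ q, Integrable (X q) μ := fun q => (hX.memLp q).integrable one_le_two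
  simp only [res]
  rw [integral_sub (hi p) (integrable_finsetSum _ fun q _ => (hi q).const_mul _),
    integral_finsetSum _ fun q _ => (hi q).const_mul _]
  simp [integral_const_mul, hX.mean_zero]

/-- Residuals that are uncorrelated with `X|T` are independent of `X|T`. -/
theorem indepFun_res (hX : IsCenteredGaussian μ X) {S A T : Set ι}
    (h : ∀ p ∈ A, ∀ q ∈ T, ⟪residual hX.toL2 S p, hX.toL2 q⟫ = 0) :
    IndepFun (fun ω (p : A) => hX.res S p ω) (fun ω (q : T) => X q ω) μ := by
  refine IsGaussianProcess.indepFun_of_covariance_eq_zero (X := fun p : A => hX.res S p)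
    (Y := fun q : T => X q) ?_ (fun p => (hX.measurable_res S p).aemeasurable)
    (fun q => (hX.measurable q).aemeasurable) fun p q => ?_
  · refine hX.gaussian.of_isGaussianProcess ?_
    rintro (p | q)
    · refine ⟨Finset.univ, ContinuousLinearMap.proj ⟨p, Finset.mem_univ _⟩
        - ∑ q, hX.regr S p q • ContinuousLinearMap.proj ⟨q, Finset.mem_univ _⟩, fun ω => ?_⟩
      simp [res]
    · exact ⟨Finset.univ, ContinuousLinearMap.proj ⟨q, Finset.mem_univ _⟩, fun ω => by simp⟩
  · rw [cov_eq_integral (hX.memLp_res S p) (hX.memLp q) (hX.mean_zero q), integral_res_mul]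
    exact h p p.2 q q.2

/-- For a Gaussian family, linear regression is the conditional expectation: the residual is
uncorrelated with X over S, hence independent of it, and has mean zero. -/
theorem condExp_eq (hX : IsCenteredGaussian μ X) (S : Set ι) (p : ι) :
    μ[X p | sigmaFam X S] =ᵐ[μ] fun ω => ∑ q, hX.regr S p q * X q ω := by
  have hsm : ∀ q ∈ S, StronglyMeasurable[sigmaFam X S] (X q) := fun q hq =>
    ((comap_measurable (X q)).mono (le_iSup₂_of_le q hq le_rfl) le_rfl).stronglyMeasurable
  have hreg : StronglyMeasurable[sigmaFam X S] fun ω => ∑ q, hX.regr S p q * X q ω := by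
    refine Finset.stronglyMeasurable_fun_sum _ fun q _ => ?_
    by_cases hq : q ∈ S
    · exact (hsm q hq).const_mul _
    · simp only [hX.regr_eq_zero p hq, zero_mul]
      exact stronglyMeasurable_const
  have hregi : Integrable (fun ω => ∑ q, hX.regr S p q * X q ω) μ :=
    integrable_finsetSum _ fun q _ => ((hX.memLp q).integrable one_le_two).const_mul _
  have hres : μ[hX.res S p | sigmaFam X S] =ᵐ[μ] fun _ => 0 := by
    have hind := hX.indepFun_res (S := S) (A := {p}) (T := S) fun _ _ q hq =>
      inner_residual_of_mem_famSpan _ _ _ (mem_famSpan hq)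
    have hind' : IndepFun (hX.res S p) (fun ω (q : S) => X q ω) μ :=
      hind.comp (measurable_pi_apply (⟨p, rfl⟩ : ({p} : Set ι))) measurable_id
    have := condExp_indep_eq (hX.measurable_res S p).comap_le (hX.sigmaFam_le S)
      (comap_measurable (hX.res S p)).stronglyMeasurable
      (by rw [sigmaFam_eq_comap]; exact hind')
    rwa [hX.integral_res] at this
  have hsplit : X p = hX.res S p + fun ω => ∑ q, hX.regr S p q * X q ω := by
    ext ω
    simp [res]
  calc μ[X p | sigmaFam X S]
      =ᵐ[μ] μ[hX.res S p + fun ω => ∑ q, hX.regr S p q * X q ω | sigmaFam X S] := by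
        rw [← hsplit]
    _ =ᵐ[μ] μ[hX.res S p | sigmaFam X S]
          + μ[fun ω => ∑ q, hX.regr S p q * X q ω | sigmaFam X S] :=
        condExp_add ((hX.memLp_res S p).integrable one_le_two) hregi _
    _ =ᵐ[μ] fun ω => ∑ q, hX.regr S p q * X q ω := by
        rw [condExp_of_stronglyMeasurable (hX.sigmaFam_le S) hreg hregi]
        filter_upwards [hres] with ω hω
        simp [hω]

/-- By `condExp_eq` the residual is X p - E[X p | X over S], which conditional independence makes
orthogonal to X over B. -/
theorem condUncorr_of_condIndepGiven (hX : IsCenteredGaussian μ X) {S A B : Set ι}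
    (h : CondIndepGiven μ (sigmaFam X S) (sigmaFam X A) (sigmaFam X B)) :
    CondUncorr hX.toL2 S A B := by
  intro p hp q hq
  have hsm : ∀ {T : Set ι} {r : ι}, r ∈ T → StronglyMeasurable[sigmaFam X T] (X r) := fun hr =>
    ((comap_measurable (X _)).mono (le_iSup₂_of_le _ hr le_rfl) le_rfl).stronglyMeasurable
  rw [← integral_res_mul, ← h.integral_sub_condExp_mul (hX.sigmaFam_le S) (hX.sigmaFam_le A)
    (hX.sigmaFam_le B) (hsm hp) (hsm hq) (hX.memLp p) (hX.memLp q)]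
  refine integral_congr_ae ?_
  filter_upwards [hX.condExp_eq S p] with ω hω
  rw [hω, mul_comm, res]

/-- X over A is its residual plus a linear function of X over S, and the residual is independent of
X over S ∪ B. Conditioning on S ∪ B or on S alone therefore integrates out the same residual law and
gives the same function of X over S. -/
theorem condIndepGiven_of_condUncorr (hX : IsCenteredGaussian μ X) {S A B : Set ι}
    (h : CondUncorr hX.toL2 S A B) :
    CondIndepGiven μ (sigmaFam X S) (sigmaFam X A) (sigmaFam X B) := by
  refine condIndepGiven_of_condExp_eq (m₃ := sigmaFam X (S ∪ B)) (hX.sigmaFam_le A)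
    (hX.sigmaFam_le _) (sigmaFam_mono X Set.subset_union_left)
    (sigmaFam_mono X Set.subset_union_right) fun E hE => ?_
  rw [sigmaFam_eq_comap] at hE
  obtain ⟨F, hF, rfl⟩ := hE
  classical
  have hRm : Measurable fun ω (p : A) => hX.res S p ω :=
    measurable_pi_lambda _ fun p => hX.measurable_res S p
  have key : ∀ T : Set ι, S ⊆ T → T ⊆ S ∪ B →
      μ[((fun ω (p : A) => X p ω) ⁻¹' F).indicator (fun _ => (1 : ℝ)) | sigmaFam X T] =ᵐ[μ]
        fun ω => ∫ r, F.indicator (fun _ => (1 : ℝ))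
          (fun p : A => r p + ∑ q, hX.regr S p q * X q ω)
            ∂(μ.map fun ω (p : A) => hX.res S p ω) := by
    intro T hST hTB
    have hind := hX.indepFun_res (S := S) (A := A) (T := T) fun p hp q hq =>
      h.inner_residual hp (hTB hq)
    -- The default value 0 off T is harmless: the regression coefficients vanish off S, and S ⊆ T.
    let f : (T → ℝ) × (A → ℝ) → ℝ := fun z => F.indicator (fun _ => (1 : ℝ))
      fun p : A => z.2 p + ∑ q, hX.regr S p q * if hq : q ∈ T then z.1 ⟨q, hq⟩ else 0
    have hfm : Measurable f := by
      refine (measurable_const.indicator hF).comp (measurable_pi_lambda _ fun p => ?_)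
      refine ((measurable_pi_apply p).comp measurable_snd).add
        (Finset.measurable_sum _ fun q _ => Measurable.const_mul ?_ _)
      by_cases hq : q ∈ T
      · simp only [hq, dite_true]
        exact (measurable_pi_apply _).comp measurable_fst
      · simp only [hq, dite_false]
        exact measurable_const
    have hsum : ∀ ω (p : A), (∑ q, hX.regr S p q * if q ∈ T then X q ω else 0)
        = ∑ q, hX.regr S p q * X q ω := fun ω p => Finset.sum_congr rfl fun q _ => by
      by_cases hq : q ∈ T
      · simp [hq]
      · simp [hX.regr_eq_zero p fun hqS => hq (hST hqS)]
    have hf1 : ∀ r ω, f (fun q : T => X q ω, r) = F.indicator (fun _ => (1 : ℝ))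
        (fun p : A => r p + ∑ q, hX.regr S p q * X q ω) := fun r ω => by
      simp only [f, dite_eq_ite, hsum]
    have hf2 : ((fun ω (p : A) => X p ω) ⁻¹' F).indicator (fun _ => (1 : ℝ))
        = fun ω => f (fun q : T => X q ω, fun p : A => hX.res S p ω) := by
      ext ω
      rw [hf1]
      simp only [res, sub_add_cancel]
      rfl
    have hZm : Measurable fun ω (q : T) => X q ω := measurable_pi_lambda _ fun q => hX.measurable q
    have hAm : Measurable fun ω (p : A) => X p ω := measurable_pi_lambda _ fun q => hX.measurable q
    have := condExp_prod_of_indepFun hRm hZm hind hfm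
      (by rw [← hf2]; exact (integrable_const 1).indicator (hAm hF))
    rw [← hf2, ← sigmaFam_eq_comap] at this
    simpa only [hf1] using this
  exact (key _ Set.subset_union_left subset_rfl).trans (key _ subset_rfl Set.subset_union_left).symm

theorem condIndepGiven_iff (hX : IsCenteredGaussian μ X) {S A B : Set ι} :
    CondIndepGiven μ (sigmaFam X S) (sigmaFam X A) (sigmaFam X B) ↔ CondUncorr hX.toL2 S A B :=
  ⟨hX.condUncorr_of_condIndepGiven, hX.condIndepGiven_of_condUncorr⟩

end IsCenteredGaussian

end GaussianFamily

/-! ### From random vectors to their scalar components. -/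

section Coordinates

variable {Ω : Type*} {mΩ : MeasurableSpace Ω} {μ : Measure Ω} {N d : ℕ}

/-- The scalar components of a sequence of random vectors. -/
def coords (x : Fin (N + 1) → Ω → (Fin d → ℝ)) (p : Fin (N + 1) × Fin d) (ω : Ω) : ℝ := x p.1 ω p.2

/-- The indices of the scalar components of the vectors with index in `S`. -/
abbrev fib (d : ℕ) (S : Set (Fin (N + 1))) : Set (Fin (N + 1) × Fin d) := Prod.fst ⁻¹' S

theorem sigmaOf_eq_sigmaFam (x : Fin (N + 1) → Ω → (Fin d → ℝ)) (S : Set (Fin (N + 1))) :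
    sigmaOf x S = sigmaFam (coords x) (fib d S) := by
  have h : ∀ i, MeasurableSpace.comap (x i) inferInstance
      = ⨆ a, MeasurableSpace.comap (coords x (i, a)) inferInstance := fun i => by
    simp only [MeasurableSpace.pi, MeasurableSpace.comap_iSup, MeasurableSpace.comap_comp]
    rfl
  simp only [sigmaOf, sigmaFam, h]
  refine le_antisymm (iSup₂_le fun i hi => iSup_le fun a => ?_) (iSup₂_le fun p hp => ?_)
  · exact le_iSup₂_of_le (i, a) hi le_rfl
  · exact le_iSup₂_of_le p.1 hp (le_iSup_of_le p.2 le_rfl)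

theorem IsZMG.coords {x : Fin (N + 1) → Ω → (Fin d → ℝ)} (hx : IsZMG μ x) :
    IsCenteredGaussian μ (coords x) where
  measurable p := (measurable_pi_apply p.2).comp (hx.measurable p.1)
  gaussian := hx.gaussian.of_isGaussianProcess fun p =>
    ⟨{p.1}, (ContinuousLinearMap.proj (R := ℝ) (φ := fun _ : Fin d => ℝ) p.2).comp
      (ContinuousLinearMap.proj ⟨p.1, Finset.mem_singleton_self p.1⟩), fun ω => by
        simp [CMSeq.coords]⟩
  mean_zero p := hx.mean_zero p.1 p.2

variable [IsProbabilityMeasure μ]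

theorem IsZMG.crossCov_apply {x : Fin (N + 1) → Ω → (Fin d → ℝ)} (hx : IsZMG μ x)
    (i j : Fin (N + 1)) (a b : Fin d) :
    crossCov μ (x i) (x j) a b = ⟪hx.coords.toL2 (i, a), hx.coords.toL2 (j, b)⟫ := by
  rw [IsCenteredGaussian.inner_toL2]
  rfl

theorem IsZMG.isReciprocal_iff {x : Fin (N + 1) → Ω → (Fin d → ℝ)} (hx : IsZMG μ x) :
    IsReciprocal μ x ↔ ∀ j l : Fin (N + 1), j < l →
      CondUncorr hx.coords.toL2 (fib d {j, l}) (fib d (Set.Ioo j l)) (fib d (Set.Icc j l)ᶜ) := by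
  refine forall₃_congr fun j l _ => ?_
  rw [← hx.coords.condIndepGiven_iff]
  simp only [sigmaOf_eq_sigmaFam]

end Coordinates

/-! ### The factorization (*) as conditional uncorrelatedness. -/

section Factorization

variable {Ω : Type*} {mΩ : MeasurableSpace Ω} {μ : Measure Ω} {N d : ℕ}

/-- The Gram matrix of a family of vectors. -/
def gramMatrix {ι E : Type*} [NormedAddCommGroup E] [InnerProductSpace ℝ E] (ξ : ι → E) :
    Matrix ι ι ℝ := Matrix.of fun p q => ⟪ξ p, ξ q⟫

/-- Only the first Penrose equation enters, so any generalized inverse would serve. -/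
theorem mul_mpInv_mul {m n k l : Type*} [Fintype m] [Fintype n] [Fintype k] [Fintype l]
    (A : Matrix m n ℝ) (B : Matrix k m ℝ) (C : Matrix n l ℝ) :
    B * A * mpInv A * (A * C) = B * (A * C) := by
  rw [Matrix.mul_assoc B A, Matrix.mul_assoc B, ← Matrix.mul_assoc (A * mpInv A),
    (isMPInverse_mpInv A).mul_mul]

/-- Regression on x_j and x_l factors the outer matrices of (*) through the middle matrix Z, as B_k
Z and Z B_i'. The product then collapses by Z Z⁺ Z = Z, even for singular Z. -/
theorem factorizes_gramMatrix_iff {X : Fin (N + 1) × Fin d → Ω → ℝ} (hX : IsCenteredGaussian μ X)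
    {i j k l : Fin (N + 1)} (hjl : j ≠ l) :
    Factorizes (gramMatrix hX.toL2) i j k l ↔
      CondUncorr hX.toL2 (fib d {j, l}) (fib d {k}) (fib d {i}) := by
  set S : Set (Fin (N + 1) × Fin d) := fib d {j, l} with hS
  set C := gramMatrix hX.toL2 with hC
  let φ : Fin d ⊕ Fin d → Fin (N + 1) × Fin d := Sum.elim (Prod.mk j) (Prod.mk l)
  have hφ : Function.Injective φ := by
    rintro (a | a) (b | b) h <;> simp_all [φ, eq_comm]
  have hφS : ∀ s, φ s ∈ S := by
    rintro (a | a) <;> simp [φ, hS]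
  have hrange : ∀ q ∉ Set.range φ, q ∉ S := by
    rintro ⟨q, a⟩ hq hqS
    rcases hqS with h | h
    · exact hq ⟨Sum.inl a, by simpa [φ] using h.symm⟩
    · exact hq ⟨Sum.inr a, by simpa [φ] using h.symm⟩
  let B : Fin (N + 1) → Matrix (Fin d) (Fin d ⊕ Fin d) ℝ := fun k =>
    Matrix.of fun a s => hX.regr S (k, a) (φ s)
  have hres : ∀ k a q, ⟪residual hX.toL2 S (k, a), hX.toL2 q⟫
      = C (k, a) q - ∑ s, B k a s * C (φ s) q := fun k a q => by
    rw [hX.residual_eq_sub_sum, inner_sub_left, sum_inner]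
    congr 1
    refine (Fintype.sum_of_injective φ hφ _ _ (fun q hq => ?_) fun s => ?_).symm
    · simp [hX.regr_eq_zero _ (hrange q hq)]
    · rw [real_inner_smul_left]
      rfl
  let Z := C.submatrix φ φ
  -- Normal equations: the residual of each component of x_k is orthogonal to x_j and x_l.
  have hBZ : ∀ k, C.submatrix (Prod.mk k) φ = B k * Z := fun k => by
    ext a s
    have := inner_residual_of_mem_famSpan hX.toL2 S (k, a) (mem_famSpan (hφS s))
    rw [hres, sub_eq_zero] at this
    exact this
  have hCt : Cᵀ = C := by
    ext p q
    exact real_inner_comm (hX.toL2 p) (hX.toL2 q)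
  have hZB : C.submatrix φ (Prod.mk i) = Z * (B i)ᵀ := by
    have := congrArg Matrix.transpose (hBZ i)
    rwa [Matrix.transpose_mul, Matrix.transpose_submatrix, Matrix.transpose_submatrix, hCt] at this
  have hblocks : Matrix.fromBlocks (blk C j j) (blk C j l) (blk C l j) (blk C l l) = Z := by
    ext (a | a) (b | b) <;> rfl
  have hcols : Matrix.fromCols (blk C k j) (blk C k l) = C.submatrix (Prod.mk k) φ := by
    ext a (b | b) <;> rfl
  have hrows : Matrix.fromRows (blk C j i) (blk C l i) = C.submatrix φ (Prod.mk i) := by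
    ext (a | a) b <;> rfl
  -- What is left of (*) is C_{k,i} = B_k C_{S,i}: the residual of x_k is orthogonal to x_i.
  rw [Factorizes, hblocks, hcols, hrows, hBZ, hZB, mul_mpInv_mul, ← hZB]
  constructor
  · rintro h ⟨k', a⟩ hk ⟨i', b⟩ hi
    obtain rfl : k' = k := hk
    obtain rfl : i' = i := hi
    rw [hres, sub_eq_zero]
    exact congrFun (congrFun h a) b
  · intro h
    ext a b
    have := h (k, a) rfl (i, b) rfl
    rw [hres, sub_eq_zero] at this
    exact this

end Factorization

/-! ### The block matrix 𝒢 and its invertibility. -/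

section ModelMatrix

variable {N d : ℕ} {E : Type*} [AddCommGroup E] [Module ℝ E]

/-- Module-valued v lets the same formula serve for sample values in ℝ and for vectors of L². -/
theorem sum_calG_smul (c : Fin (N + 1)) (G : Fin (N + 1) → Fin (N + 1) → Matrix (Fin d) (Fin d) ℝ)
    (v : Fin (N + 1) × Fin d → E) (i : Fin (N + 1)) (a : Fin d) :
    ∑ q, calG c G (i, a) q • v q = v (i, a)
      - (∑ j : Fin (N + 1), if i ≠ c ∧ (j : ℕ) + 1 = i then ∑ b, G i j a b • v (j, b) else 0)
      - (if i ≠ c then ∑ b, G i c a b • v (c, b) else 0) := by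
  have h : ∀ j b, calG c G (i, a) (j, b) • v (j, b)
      = (if i = j then (1 : Matrix (Fin d) (Fin d) ℝ) a b • v (j, b) else 0)
        - (if i ≠ c ∧ (j : ℕ) + 1 = i then G i j a b • v (j, b) else 0)
        - (if j = c then (if i ≠ c then G i c a b • v (j, b) else 0) else 0) := fun j b => by
    simp only [calG, Matrix.comp_apply, Matrix.of_apply, Matrix.sub_apply, sub_smul]
    congr 1
    · congr 1 <;> split_ifs <;> simp
    · by_cases h1 : i = c <;> by_cases h2 : j = c <;> simp [h1, h2]
  rw [Fintype.sum_prod_type]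
  simp only [h, Finset.sum_sub_distrib]
  congr 1
  · congr 1
    · rw [Finset.sum_eq_single i]
      · simp [Matrix.one_apply, ite_smul]
      · intro j _ hj
        simp [hj.symm]
      · simp
    · refine Finset.sum_congr rfl fun j _ => ?_
      split_ifs <;> simp
  · rw [Finset.sum_eq_single c]
    · by_cases hi : i = c
      · simp [hi]
      · simp [hi]
    · intro j _ hj
      simp [hj]
    · simp

variable (c : Fin (N + 1)) (G : Fin (N + 1) → Fin (N + 1) → Matrix (Fin d) (Fin d) ℝ)
  (v : Fin (N + 1) × Fin d → E)

theorem sum_calG_smul_boundary (a : Fin d) : ∑ q, calG c G (c, a) q • v q = v (c, a) := by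
  simp [sum_calG_smul]

theorem sum_calG_smul_zero (hc : c ≠ 0) (a : Fin d) :
    ∑ q, calG c G (0, a) q • v q = v (0, a) - ∑ b, G 0 c a b • v (c, b) := by
  simp [sum_calG_smul, hc.symm]

theorem sum_calG_smul_succ (k : Fin N) (hk : k.succ ≠ c) (a : Fin d) :
    ∑ q, calG c G (k.succ, a) q • v q = v (k.succ, a)
      - ∑ b, G k.succ k.castSucc a b • v (k.castSucc, b) - ∑ b, G k.succ c a b • v (c, b) := by
  rw [sum_calG_smul, Finset.sum_eq_single k.castSucc]
  · simp [hk]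
  · intro j _ hj
    rw [if_neg]
    rintro ⟨-, h⟩
    exact hj (Fin.ext (by simpa using h))
  · simp

/-- With e = 0 the model equations force x_c = 0, and then every x_k = 0 by forward recursion. -/
theorem isUnit_calG : IsUnit (calG c G) := by
  rw [← Matrix.mulVec_injective_iff_isUnit, ← Matrix.coe_mulVecLin, ← LinearMap.ker_eq_bot,
    LinearMap.ker_eq_bot']
  intro v hv
  have h : ∀ p, ∑ q, calG c G p q • v q = 0 := fun p => congrFun hv p
  have hc : ∀ a, v (c, a) = 0 := fun a => by rw [← sum_calG_smul_boundary c G v, h]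
  have hall : ∀ n a, v (n, a) = 0 := fun n => by
    induction n using Fin.induction with
    | zero =>
      intro a
      by_cases h0 : c = 0
      · exact h0 ▸ hc a
      · have := h (0, a)
        rw [sum_calG_smul_zero c G v h0] at this
        simpa [hc] using this
    | succ k ih =>
      intro a
      by_cases hk : k.succ = c
      · rw [hk]
        exact hc a
      · have := h (k.succ, a)
        rw [sum_calG_smul_succ c G v k hk] at this
        simpa [hc, ih] using this
  exact funext fun p => hall p.1 p.2

end ModelMatrix

theorem IsCenteredGaussian.toL2_eq_sum {ι κ Ω : Type*} [Fintype ι] {mΩ : MeasurableSpace Ω}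
    {μ : Measure Ω} {X : ι → Ω → ℝ} {Y : κ → Ω → ℝ} (hX : IsCenteredGaussian μ X)
    (hY : IsCenteredGaussian μ Y) {p : κ} {c : ι → ℝ}
    (h : ∀ᵐ ω ∂μ, Y p ω = ∑ q, c q * X q ω) : hY.toL2 p = ∑ q, c q • hX.toL2 q := by
  refine Lp.ext ?_
  filter_upwards [h, (hY.memLp p).coeFn_toLp, hX.coeFn_sum_smul_toL2 c] with ω h1 h2 h3
  rw [h3, ← h1, toL2, h2]

/-! ### The Markov property of a model relative to the state at c. -/

section Markov

variable {N d : ℕ} {E : Type*} [NormedAddCommGroup E] [InnerProductSpace ℝ E]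

theorem sum_smul_mem_famSpan_fib (ξ : Fin (N + 1) × Fin d → E) {S : Set (Fin (N + 1))}
    {n : Fin (N + 1)} (hn : n ∈ S) (c : Fin d → ℝ) : ∑ b, c b • ξ (n, b) ∈ famSpan ξ (fib d S) :=
  Submodule.sum_mem _ fun _ _ => Submodule.smul_mem _ _ (mem_famSpan hn)

/-- In a `CM_c` model, the present and the future are uncorrelated with the past given the present
and the state at time `c`. -/
theorem condUncorr_of_model {c : Fin (N + 1)} {ξ η : Fin (N + 1) × Fin d → E}
    (hdyn : ∀ k : Fin N, k.succ ≠ c → ∀ a,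
      ξ (k.succ, a) - η (k.succ, a) ∈ famSpan ξ (fib d {k.castSucc, c}))
    (hbc : ∀ a, ξ (c, a) = η (c, a))
    (hbz : c ≠ 0 → ∀ a, ξ (0, a) - η (0, a) ∈ famSpan ξ (fib d {c}))
    (hwhite : ∀ p q, p.1 ≠ q.1 → ⟪η p, η q⟫ = 0) (l : Fin (N + 1)) :
    CondUncorr ξ (fib d {l, c}) (fib d (Set.Ici l)) (fib d (Set.Iic l)) := by
  have hc : ∀ {S : Set (Fin (N + 1))} (_ : c ∈ S) (a : Fin d), ξ (c, a) ∈ famSpan η (fib d S) :=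
    fun hS a => hbc a ▸ mem_famSpan hS
  -- Solving the recursion forward from the boundary: each state is a combination of the noise up to
  -- its own time and of e_c.
  have past : ∀ n a, ξ (n, a) ∈ famSpan η (fib d (Set.Iic n ∪ {c})) := fun n => by
    induction n using Fin.induction with
    | zero =>
      intro a
      by_cases h0 : c = 0
      · subst h0
        exact hc (Or.inr rfl) a
      · rw [← sub_add_cancel (ξ (0, a)) (η (0, a))]
        refine Submodule.add_mem _ (famSpan_le ?_ (hbz h0 a))
          (mem_famSpan (Or.inl Set.self_mem_Iic))
        rintro ⟨n, b⟩ rfl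
        exact hc (Or.inr rfl) b
    | succ k ih =>
      intro a
      by_cases hk : k.succ = c
      · rw [hk]
        exact hc (Or.inr rfl) a
      · rw [← sub_add_cancel (ξ (k.succ, a)) (η (k.succ, a))]
        refine Submodule.add_mem _ (famSpan_le ?_ (hdyn k hk a))
          (mem_famSpan (Or.inl Set.self_mem_Iic))
        rintro ⟨n, b⟩ (rfl | rfl)
        · refine famSpan_mono (Set.preimage_mono (Set.union_subset_union_left _ ?_)) (ih b)
          exact Set.Iic_subset_Iic.2 (Fin.castSucc_lt_succ).le
        · exact hc (Or.inr rfl) b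
  -- Solving it from time l instead: beyond x_l and x_c, only noise after l other than e_c enters.
  -- This noise part r serves as the residual.
  have future : ∀ n, l ≤ n → ∀ a,
      ξ (n, a) ∈ famSpan ξ (fib d {l, c}) ⊔ famSpan η (fib d (Set.Ioi l \ {c})) := fun n => by
    induction n using Fin.induction with
    | zero =>
      intro hl a
      exact Submodule.mem_sup_left (mem_famSpan (Or.inl (le_antisymm (Fin.zero_le _) hl)))
    | succ k ih =>
      intro hl a
      rcases hl.eq_or_lt with rfl | hl
      · exact Submodule.mem_sup_left (mem_famSpan (Or.inl rfl))
      by_cases hk : k.succ = c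
      · exact Submodule.mem_sup_left (mem_famSpan (Or.inr hk))
      · rw [← sub_add_cancel (ξ (k.succ, a)) (η (k.succ, a))]
        refine Submodule.add_mem _ (famSpan_le ?_ (hdyn k hk a))
          (Submodule.mem_sup_right (mem_famSpan ⟨hl, hk⟩))
        rintro ⟨n, b⟩ (rfl | rfl)
        · exact ih (Fin.le_castSucc_iff.2 hl) b
        · exact Submodule.mem_sup_left (mem_famSpan (Or.inr rfl))
  refine CondUncorr.of_exists ?_
  rintro ⟨n, a⟩ hn
  obtain ⟨s, hs, r, hr, hsr⟩ := Submodule.mem_sup.1 (future n hn a)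
  refine ⟨r, by rwa [← hsr, add_sub_cancel_right], ?_⟩
  rintro ⟨m, b⟩ hm
  have hm' : ξ (m, b) ∈ famSpan η (fib d (Set.Iic l ∪ {c})) := by
    rcases hm with (rfl | rfl) | hm
    · exact past _ b
    · exact hc (Or.inr rfl) b
    · exact famSpan_mono (Set.preimage_mono
        (Set.union_subset_union_left _ (Set.Iic_subset_Iic.2 hm))) (past m b)
  refine inner_eq_zero_of_mem_famSpan (fun p hp => ?_) hm'
  rw [real_inner_comm]
  -- The two noise spans involve disjoint sets of times, Iic l ∪ {c} and Ioi l \ {c}.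
  refine inner_eq_zero_of_mem_famSpan (fun q hq => hwhite p q fun hpq => ?_) hr
  rcases hp with hp | hp
  · exact not_lt_of_ge (Set.mem_Iic.1 hp) (hpq ▸ hq.1)
  · exact hq.2 (hpq ▸ hp)

end Markov

/-! ### Covariance and Markov property of a sequence obeying a model. -/

section Model

variable {Ω : Type*} {mΩ : MeasurableSpace Ω} {μ : Measure Ω} {N d : ℕ} {c : Fin (N + 1)}
  {G : Fin (N + 1) → Fin (N + 1) → Matrix (Fin d) (Fin d) ℝ} {e x : Fin (N + 1) → Ω → (Fin d → ℝ)}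

theorem ObeysCMModel.coords_eq_sum (h : ObeysCMModel μ c G e x) (p : Fin (N + 1) × Fin d) :
    ∀ᵐ ω ∂μ, coords e p ω = ∑ q, calG c G p q * coords x q ω := by
  obtain ⟨i, a⟩ := p
  simp only [← smul_eq_mul (calG c G _ _)]
  by_cases hi : i = c
  · subst hi
    filter_upwards [h.boundary_c] with ω hω
    rw [sum_calG_smul_boundary i G fun q => coords x q ω]
    simp [coords, hω]
  · cases i using Fin.cases with
    | zero =>
      filter_upwards [h.boundary_zero (Ne.symm hi)] with ω hω
      rw [sum_calG_smul_zero c G (fun q => coords x q ω) (Ne.symm hi)]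
      simp [coords, hω, Matrix.mulVec, dotProduct]
    | succ k =>
      filter_upwards [h.dynamics k hi] with ω hω
      rw [sum_calG_smul_succ c G (fun q => coords x q ω) k hi]
      simp only [coords, hω, Matrix.mulVec, dotProduct, Pi.add_apply, smul_eq_mul]
      ring

variable [IsProbabilityMeasure μ]

theorem IsWhiteZMG.inner_toL2_eq_zero (he : IsWhiteZMG μ e) {p q : Fin (N + 1) × Fin d}
    (h : p.1 ≠ q.1) : ⟪he.coords.toL2 p, he.coords.toL2 q⟫ = 0 := by
  rw [← he.toIsZMG.crossCov_apply p.1 q.1 p.2 q.2, he.white p.1 q.1 h, Matrix.zero_apply]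

/-- The matrix `P` of a `CM_c` model is the covariance matrix of the sequence. -/
theorem ObeysCMModel.modelCov_eq (h : ObeysCMModel μ c G e x) (hx : IsZMG μ x) :
    modelCov c G (fun t => crossCov μ (e t) (e t)) = gramMatrix hx.coords.toL2 := by
  set C := gramMatrix hx.coords.toL2 with hC
  have hCpq : ∀ p q, C p q = ⟪hx.coords.toL2 p, hx.coords.toL2 q⟫ := fun _ _ => rfl
  -- The covariance of e = 𝒢x computed in two ways: block diagonal by whiteness, and 𝒢 C 𝒢' by
  -- bilinearity.
  have he : Matrix.comp _ _ _ _ ℝ (Matrix.diagonal fun t => crossCov μ (e t) (e t))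
      = calG c G * C * (calG c G)ᵀ := by
    ext ⟨i, a⟩ ⟨j, b⟩
    have h1 : Matrix.comp _ _ _ _ ℝ (Matrix.diagonal fun t => crossCov μ (e t) (e t)) (i, a) (j, b)
        = ⟪h.white.coords.toL2 (i, a), h.white.coords.toL2 (j, b)⟫ := by
      rw [Matrix.comp_apply]
      by_cases hij : i = j
      · subst hij
        rw [Matrix.diagonal_apply_eq, h.white.toIsZMG.crossCov_apply]
      · rw [Matrix.diagonal_apply_ne _ hij, h.white.inner_toL2_eq_zero hij, Matrix.zero_apply]
    rw [h1, hx.coords.toL2_eq_sum h.white.coords (h.coords_eq_sum _),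
      hx.coords.toL2_eq_sum h.white.coords (h.coords_eq_sum _), inner_sum]
    rw [Matrix.mul_apply]
    refine Finset.sum_congr rfl fun q _ => ?_
    rw [sum_inner, Matrix.mul_apply, Finset.sum_mul]
    refine Finset.sum_congr rfl fun p _ => ?_
    rw [real_inner_smul_left, real_inner_smul_right, hCpq, Matrix.transpose_apply]
    ring
  have hdet : IsUnit (calG c G).det := (Matrix.isUnit_iff_isUnit_det _).1 (isUnit_calG c G)
  have hdet' : IsUnit (calG c G)ᵀ.det := by rwa [Matrix.det_transpose]
  rw [modelCov, he, Matrix.mul_assoc (calG c G), Matrix.nonsing_inv_mul_cancel_left _ _ hdet,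
    Matrix.mul_nonsing_inv_cancel_right _ _ hdet']

theorem ObeysCMModel.condUncorr (h : ObeysCMModel μ c G e x) (hx : IsZMG μ x) (l : Fin (N + 1)) :
    CondUncorr hx.coords.toL2 (fib d {l, c}) (fib d (Set.Ici l)) (fib d (Set.Iic l)) := by
  have hη := fun p => hx.coords.toL2_eq_sum h.white.coords (h.coords_eq_sum p)
  refine condUncorr_of_model (η := h.white.coords.toL2) (fun k hk a => ?_) (fun a => ?_)
    (fun hc a => ?_) (fun p q => h.white.inner_toL2_eq_zero) l
  · rw [hη, sum_calG_smul_succ c G _ k hk, sub_sub, sub_sub_cancel]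
    exact Submodule.add_mem _ (sum_smul_mem_famSpan_fib _ (by simp) _)
      (sum_smul_mem_famSpan_fib _ (by simp) _)
  · rw [hη, sum_calG_smul_boundary]
  · rw [hη, sum_calG_smul_zero c G _ hc, sub_sub_cancel]
    exact sum_smul_mem_famSpan_fib _ (Set.mem_singleton c) _

end Model

/-! ### Construction of a model from regression residuals. -/

section Existence

variable {Ω : Type*} {mΩ : MeasurableSpace Ω} {μ : Measure Ω} {N d : ℕ}
  {x : Fin (N + 1) → Ω → (Fin d → ℝ)}

/-- The parameters of the `CM_c` model of a zero-mean Gaussian sequence. For `c = 0`, the two terms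
of the equation for `x_1` coincide, whence the factor `1 / 2`. -/
def cmParam (hx : IsZMG μ x) (c i j : Fin (N + 1)) : Matrix (Fin d) (Fin d) ℝ :=
  Matrix.of fun a b =>
    Fin.cases (motive := fun _ => ℝ) (hx.coords.regr (fib d {c}) (0, a) (j, b))
      (fun k => (if k.castSucc = c then 1 / 2 else 1)
        * hx.coords.regr (fib d {k.castSucc, c}) (k.succ, a) (j, b)) i

theorem sum_calG_cmParam_zero (hx : IsZMG μ x) {c : Fin (N + 1)} (hc : c ≠ 0) (a : Fin d) :
    ∑ q, calG c (cmParam hx c) (0, a) q • hx.coords.toL2 q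
      = residual hx.coords.toL2 (fib d {c}) (0, a) := by
  rw [sum_calG_smul_zero c _ _ hc, hx.coords.residual_eq_sub_sum, Fintype.sum_prod_type]
  congr 1
  rw [Finset.sum_eq_single c]
  · simp [cmParam]
  · intro j _ hj
    exact Finset.sum_eq_zero fun b _ => by
      rw [hx.coords.regr_eq_zero _ (by simpa using hj), zero_smul]
  · simp

theorem sum_calG_cmParam_succ (hx : IsZMG μ x) {c : Fin (N + 1)} (k : Fin N) (hk : k.succ ≠ c)
    (a : Fin d) : ∑ q, calG c (cmParam hx c) (k.succ, a) q • hx.coords.toL2 q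
      = residual hx.coords.toL2 (fib d {k.castSucc, c}) (k.succ, a) := by
  rw [sum_calG_smul_succ c _ _ k hk, hx.coords.residual_eq_sub_sum, Fintype.sum_prod_type,
    sub_sub]
  congr 1
  by_cases hkc : k.castSucc = c
  -- The predecessor is c itself, so the two model terms coincide and the halves add up to the full
  -- regression coefficient.
  · subst hkc
    rw [Finset.sum_eq_single k.castSucc]
    · rw [← Finset.sum_add_distrib]
      refine Finset.sum_congr rfl fun b _ => ?_
      rw [← add_smul]
      congr 1
      simp only [cmParam, Matrix.of_apply, Fin.cases_succ, if_true]
      ring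
    · intro j _ hj
      exact Finset.sum_eq_zero fun b _ => by
        rw [hx.coords.regr_eq_zero _ (by simpa using hj), zero_smul]
    · simp
  · rw [Finset.sum_eq_add k.castSucc c hkc]
    · simp [cmParam, hkc]
    · rintro j _ ⟨hj, hj'⟩
      exact Finset.sum_eq_zero fun b _ => by
        rw [hx.coords.regr_eq_zero _ (by simp [hj, hj']), zero_smul]
    · simp
    · simp

variable [IsProbabilityMeasure μ]

/-- A zero-mean Gaussian sequence with `x_{k+1}` uncorrelated with the past given `x_k` and `x_c`
obeys a `CM_c` model. -/
theorem exists_obeysCMModel (hx : IsZMG μ x) (c : Fin (N + 1))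
    (h : ∀ k : Fin N, k.succ ≠ c → CondUncorr hx.coords.toL2 (fib d {k.castSucc, c})
      (fib d {k.succ}) (fib d (Set.Iio k.castSucc))) :
    ∃ (G : Fin (N + 1) → Fin (N + 1) → Matrix (Fin d) (Fin d) ℝ)
      (e : Fin (N + 1) → Ω → (Fin d → ℝ)), ObeysCMModel μ c G e x := by
  set G := cmParam hx c with hG
  set ξ := hx.coords.toL2
  -- The driving sequence is defined as 𝒢x, so the model equations hold by construction and
  -- whiteness is what must be proved.
  let e : Fin (N + 1) → Ω → (Fin d → ℝ) := fun i ω a => ∑ q, calG c G (i, a) q * coords x q ω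
  have heZ : IsZMG μ e := by
    refine ⟨fun k => measurable_pi_lambda _ fun a => Finset.measurable_sum _ fun q _ =>
      (hx.coords.measurable q).const_mul _, hx.coords.gaussian.of_isGaussianProcess fun k =>
      ⟨Finset.univ, ContinuousLinearMap.pi fun a => ∑ q, calG c G (k, a) q •
        ContinuousLinearMap.proj ⟨q, Finset.mem_univ q⟩, fun ω => ?_⟩, fun k a => ?_⟩
    · ext a
      simp [e]
    · have hi : ∀ q, Integrable (fun ω => calG c G (k, a) q * coords x q ω) μ := fun q =>
        ((hx.coords.memLp q).integrable one_le_two).const_mul _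
      simp only [e]
      rw [integral_finsetSum _ fun q _ => hi q]
      simp [integral_const_mul, hx.coords.mean_zero]
  have hη : ∀ p, heZ.coords.toL2 p = ∑ q, calG c G p q • ξ q := fun p =>
    hx.coords.toL2_eq_sum heZ.coords (Filter.Eventually.of_forall fun ω => rfl)
  have hηc : ∀ a, heZ.coords.toL2 (c, a) = ξ (c, a) := fun a => by
    rw [hη, sum_calG_smul_boundary]
  have hmem : ∀ i, i ≠ c → ∀ a, heZ.coords.toL2 (i, a) ∈ famSpan ξ (fib d (Set.Iic i ∪ {c})) := by
    intro i hi a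
    cases i using Fin.cases with
    | zero =>
      rw [hη, sum_calG_smul_zero c G ξ (Ne.symm hi)]
      exact Submodule.sub_mem _ (mem_famSpan (by simp)) (sum_smul_mem_famSpan_fib _ (by simp) _)
    | succ k =>
      rw [hη, sum_calG_smul_succ c G ξ k hi]
      exact Submodule.sub_mem _ (Submodule.sub_mem _ (mem_famSpan (by simp))
        (sum_smul_mem_famSpan_fib _ (by simp [(Fin.castSucc_lt_succ).le]) _))
        (sum_smul_mem_famSpan_fib _ (by simp) _)
  -- For i ≠ c, e_i is the residual of x_i on its predecessor (if any) and x_c; the one-step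
  -- hypothesis extends its orthogonality to the entire past. By `hmem` this past, with x_c,
  -- contains every earlier noise.
  have horth : ∀ i, i ≠ c → ∀ a (n : Fin (N + 1)), n < i ∨ n = c → ∀ b,
      ⟪heZ.coords.toL2 (i, a), ξ (n, b)⟫ = 0 := by
    intro i hi a n hn b
    cases i using Fin.cases with
    | zero =>
      rw [hη, hG, sum_calG_cmParam_zero hx (Ne.symm hi)]
      exact inner_residual_of_mem_famSpan _ _ _
        (mem_famSpan (hn.resolve_left (Fin.not_lt_zero n)))
    | succ k =>
      rw [hη, hG, sum_calG_cmParam_succ hx k hi]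
      refine (h k hi).inner_residual rfl ?_
      rcases hn with hn | hn
      · rcases (Fin.le_castSucc_iff.2 hn).eq_or_lt with hn | hn
        · exact Or.inl (Or.inl hn)
        · exact Or.inr hn
      · exact Or.inl (Or.inr hn)
  have hlt : ∀ i j : Fin (N + 1), i ≠ c → j ≠ c → i < j → ∀ a b,
      ⟪heZ.coords.toL2 (j, b), heZ.coords.toL2 (i, a)⟫ = 0 := by
    intro i j hi hj hij a b
    refine inner_eq_zero_of_mem_famSpan ?_ (hmem i hi a)
    rintro ⟨n, b'⟩ (hn | hn)
    · exact horth j hj b n (Or.inl (lt_of_le_of_lt hn hij)) b'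
    · exact horth j hj b n (Or.inr hn) b'
  have hwhite : ∀ k j : Fin (N + 1), k ≠ j → crossCov μ (e k) (e j) = 0 := by
    intro k j hkj
    ext a b
    rw [heZ.crossCov_apply, Matrix.zero_apply]
    by_cases hk : k = c
    · rw [real_inner_comm, hk, hηc]
      exact horth j (fun hj => hkj (hk.trans hj.symm)) b c (Or.inr rfl) a
    by_cases hj : j = c
    · rw [hj, hηc]
      exact horth k hk a c (Or.inr rfl) b
    rcases hkj.lt_or_gt with hlt' | hlt'
    · rw [real_inner_comm]
      exact hlt k j hk hj hlt' a b
    · exact hlt j k hj hk hlt' b a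
  refine ⟨G, e, ⟨heZ, hwhite⟩, fun k hk => ?_, ?_, fun hc => ?_⟩
  · refine Filter.Eventually.of_forall fun ω => funext fun a => ?_
    have : e k.succ ω a = _ := sum_calG_smul_succ c G (fun q => coords x q ω) k hk a
    simp only [Pi.add_apply, this, Matrix.mulVec, dotProduct, smul_eq_mul, coords]
    ring
  · refine Filter.Eventually.of_forall fun ω => funext fun a => ?_
    exact (sum_calG_smul_boundary c G (fun q => coords x q ω) a).symm
  · refine Filter.Eventually.of_forall fun ω => funext fun a => ?_
    have : e 0 ω a = _ := sum_calG_smul_zero c G (fun q => coords x q ω) hc a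
    simp only [Pi.add_apply, this, Matrix.mulVec, dotProduct, smul_eq_mul, coords]
    ring

end Existence

/-! ### Reciprocity and the two models. -/

section Reciprocity

variable {Ω : Type*} {mΩ : MeasurableSpace Ω} {μ : Measure Ω} [IsProbabilityMeasure μ] {N d : ℕ}
  {x : Fin (N + 1) → Ω → (Fin d → ℝ)}

/-- A reciprocal sequence obeys a `CM_N` model. -/
theorem exists_obeysCMModel_last (hx : IsZMG μ x) (h : IsReciprocal μ x) :
    ∃ (G : Fin (N + 1) → Fin (N + 1) → Matrix (Fin d) (Fin d) ℝ)
      (e : Fin (N + 1) → Ω → (Fin d → ℝ)), ObeysCMModel μ (Fin.last N) G e x := by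
  refine exists_obeysCMModel hx _ fun k hk =>
    (hx.isReciprocal_iff.1 h k.castSucc (Fin.last N) (Fin.castSucc_lt_last k)).mono ?_ ?_
  · rintro ⟨n, a⟩ hn
    obtain rfl : n = k.succ := hn
    exact ⟨Fin.castSucc_lt_succ, lt_of_le_of_ne (Fin.le_last _) hk⟩
  · exact fun p hp hp' => absurd hp'.1 (not_le_of_gt hp)

/-- A reciprocal sequence obeys a `CM_0` model. -/
theorem exists_obeysCMModel_zero (hx : IsZMG μ x) (h : IsReciprocal μ x) :
    ∃ (G : Fin (N + 1) → Fin (N + 1) → Matrix (Fin d) (Fin d) ℝ)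
      (e : Fin (N + 1) → Ω → (Fin d → ℝ)), ObeysCMModel μ 0 G e x := by
  refine exists_obeysCMModel hx _ fun k _ => ?_
  by_cases hk : k.castSucc = 0
  · rintro p - q hq
    exact absurd (hk ▸ hq : q.1 < 0) (Fin.not_lt_zero _)
  -- Reciprocity on [0, k] separates the states after k from those strictly between. The remaining
  -- past state x_0 belongs to the conditioning, so it may be added.
  · have hr := (hx.isReciprocal_iff.1 h 0 k.castSucc (Fin.pos_iff_ne_zero.2 hk)).symm
    rw [Set.pair_comm] at hr
    refine hr.weak_union_of_subset subset_rfl Set.subset_union_left ?_ |>.mono ?_ subset_rfl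
    · rintro ⟨n, a⟩ hn
      rcases eq_or_ne n 0 with rfl | h0
      · exact Or.inl (Or.inr rfl)
      · exact Or.inr ⟨Fin.pos_iff_ne_zero.2 h0, hn⟩
    · rintro ⟨n, a⟩ hn hn'
      obtain rfl : n = k.succ := hn
      exact absurd hn'.2 (not_le_of_gt Fin.castSucc_lt_succ)

theorem isReciprocal_of_obeysCMModel_last (hx : IsZMG μ x)
    {G : Fin (N + 1) → Fin (N + 1) → Matrix (Fin d) (Fin d) ℝ} {e : Fin (N + 1) → Ω → (Fin d → ℝ)}
    (h : ObeysCMModel μ (Fin.last N) G e x)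
    (hf : ∀ i j k l : Fin (N + 1), l < i → i < j → j < k →
      Factorizes (gramMatrix hx.coords.toL2) i j k l) : IsReciprocal μ x := by
  refine hx.isReciprocal_iff.2 fun l j hlj => ?_
  have hM := (h.condUncorr hx l).symm
  rcases (Fin.le_last j).eq_or_lt with rfl | hj
  · refine hM.symm.mono (Set.preimage_mono fun i hi => hi.1.le) ?_
    exact Set.preimage_mono fun i hi => not_lt.1 fun hli => hi ⟨hli.le, Fin.le_last i⟩
  · have h1 : CondUncorr hx.coords.toL2 (fib d {l, j}) (fib d (Set.Ioo l j))
        (fib d (Set.Ioi j)) := by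
      rintro ⟨i, a⟩ hi ⟨k, b⟩ hk
      have := (factorizes_gramMatrix_iff hx.coords (hlj.ne')).1 (hf i j k l hi.1 hi.2 hk)
      rw [Set.pair_comm] at this
      exact this.symm _ rfl _ rfl
    -- The Markov property at l conditions on x_l and x_N. Since j < N, x_N is among the states
    -- after j, so weak union can enlarge the conditioning to x_l, x_j and all of these.
    have h2 : CondUncorr hx.coords.toL2 (fib d {l, j} ∪ fib d (Set.Ioi j)) (fib d (Set.Ioo l j))
        (fib d (Set.Iio l)) := by
      refine ((hM.mono (Set.preimage_mono Set.Iio_subset_Iic_self) subset_rfl).weak_union_of_subset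
        ?_ ?_ ?_).symm
      · rintro ⟨n, a⟩ (hn | hn)
        · exact Or.inl (Or.inl hn)
        · obtain rfl : n = Fin.last N := hn
          exact Or.inr hj
      · rintro ⟨n, a⟩ ((hn | hn) | hn)
        · exact Or.inl (Or.inl hn)
        · exact Or.inr (hlj.le.trans_eq (Eq.symm hn))
        · exact Or.inr (hlj.trans hn).le
      · exact fun p hp => Or.inr hp.1.le
    refine (h1.contraction h2).mono subset_rfl fun p hp => ?_
    rcases lt_or_ge p.1 l with hpl | hpl
    · exact Or.inr hpl
    · exact Or.inl (not_le.1 fun hpj => hp ⟨hpl, hpj⟩)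

theorem isReciprocal_of_obeysCMModel_zero (hx : IsZMG μ x)
    {G : Fin (N + 1) → Fin (N + 1) → Matrix (Fin d) (Fin d) ℝ} {e : Fin (N + 1) → Ω → (Fin d → ℝ)}
    (h : ObeysCMModel μ 0 G e x)
    (hf : ∀ i j k l : Fin (N + 1), i < j → j < k → k < l →
      Factorizes (gramMatrix hx.coords.toL2) i j k l) : IsReciprocal μ x := by
  refine hx.isReciprocal_iff.2 fun j l hjl => ?_
  have hM := h.condUncorr hx l
  rcases eq_or_ne j 0 with rfl | hj
  · rw [Set.pair_comm]
    refine hM.symm.mono (Set.preimage_mono fun i hi => hi.2.le) ?_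
    exact Set.preimage_mono fun i hi => not_lt.1 fun hil => hi ⟨Fin.zero_le i, hil.le⟩
  · have h1 : CondUncorr hx.coords.toL2 (fib d {j, l}) (fib d (Set.Ioo j l))
        (fib d (Set.Iio j)) := by
      rintro ⟨k, a⟩ hk ⟨i, b⟩ hi
      exact (factorizes_gramMatrix_iff hx.coords hjl.ne).1 (hf i j k l hi hk.1 hk.2) _ rfl _ rfl
    -- Here the Markov property is taken at l, with x_0 as the second conditioning state. As j ≠ 0,
    -- x_0 lies among the states before j, which are added to the conditioning.
    have h2 : CondUncorr hx.coords.toL2 (fib d {j, l} ∪ fib d (Set.Iio j)) (fib d (Set.Ioo j l))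
        (fib d (Set.Ioi l)) := by
      refine ((hM.mono (Set.preimage_mono Set.Ioi_subset_Ici_self) subset_rfl).weak_union_of_subset
        ?_ ?_ ?_).symm
      · rintro ⟨n, a⟩ (hn | hn)
        · exact Or.inl (Or.inr hn)
        · obtain rfl : n = 0 := hn
          exact Or.inr (Fin.pos_iff_ne_zero.2 hj)
      · rintro ⟨n, a⟩ ((hn | hn) | hn)
        · exact Or.inr (le_of_eq_of_le hn hjl.le)
        · exact Or.inl (Or.inl hn)
        · exact Or.inr (lt_trans hn hjl).le
      · exact fun p hp => Or.inr hp.2.le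
    refine (h1.contraction h2).mono subset_rfl fun p hp => ?_
    rcases lt_or_ge p.1 j with hpj | hpj
    · exact Or.inl hpj
    · exact Or.inr (not_le.1 fun hpl => hp ⟨hpj, hpl⟩)

end Reciprocity

end CMSeq

end

theorem theorem5 {Ω : Type*} [MeasurableSpace Ω] (μ : Measure Ω) [IsProbabilityMeasure μ]
    {N d : ℕ} (x : Fin (N + 1) → Ω → (Fin d → ℝ)) (hx : CMSeq.IsZMG μ x) :
    (CMSeq.IsReciprocal μ x ↔
      ∃ (G : Fin (N + 1) → Fin (N + 1) → Matrix (Fin d) (Fin d) ℝ)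
        (e : Fin (N + 1) → Ω → (Fin d → ℝ)),
        CMSeq.ObeysCMModel μ (Fin.last N) G e x ∧
        ∀ i j k l : Fin (N + 1), l < i → i < j → j < k →
          CMSeq.Factorizes
            (CMSeq.modelCov (Fin.last N) G (fun t => CMSeq.crossCov μ (e t) (e t))) i j k l) ∧
    (CMSeq.IsReciprocal μ x ↔
      ∃ (G : Fin (N + 1) → Fin (N + 1) → Matrix (Fin d) (Fin d) ℝ)
        (e : Fin (N + 1) → Ω → (Fin d → ℝ)),
        CMSeq.ObeysCMModel μ 0 G e x ∧
        ∀ i j k l : Fin (N + 1), i < j → j < k → k < l →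
          CMSeq.Factorizes
            (CMSeq.modelCov 0 G (fun t => CMSeq.crossCov μ (e t) (e t))) i j k l) := by
  refine ⟨⟨fun h => ?_, ?_⟩, ⟨fun h => ?_, ?_⟩⟩
  · obtain ⟨G, e, hGe⟩ := CMSeq.exists_obeysCMModel_last hx h
    refine ⟨G, e, hGe, fun i j k l hli hij hjk => ?_⟩
    -- As P is the covariance of x, (*) is reciprocity on [l, j] for one index i inside and one
    -- index k outside.
    rw [hGe.modelCov_eq hx, CMSeq.factorizes_gramMatrix_iff hx.coords (hli.trans hij).ne',
      Set.pair_comm]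
    refine (hx.isReciprocal_iff.1 h l j (hli.trans hij)).symm.mono ?_ ?_
    · rintro p rfl hp
      exact absurd hp.2 (not_le_of_gt hjk)
    · rintro p rfl
      exact ⟨hli, hij⟩
  · rintro ⟨G, e, hGe, hf⟩
    rw [hGe.modelCov_eq hx] at hf
    exact CMSeq.isReciprocal_of_obeysCMModel_last hx hGe hf
  · obtain ⟨G, e, hGe⟩ := CMSeq.exists_obeysCMModel_zero hx h
    refine ⟨G, e, hGe, fun i j k l hij hjk hkl => ?_⟩
    rw [hGe.modelCov_eq hx, CMSeq.factorizes_gramMatrix_iff hx.coords (hjk.trans hkl).ne]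
    refine (hx.isReciprocal_iff.1 h j l (hjk.trans hkl)).mono ?_ ?_
    · rintro p rfl
      exact ⟨hjk, hkl⟩
    · rintro p rfl hp
      exact absurd hp.1 (not_le_of_gt hij)
  · rintro ⟨G, e, hGe, hf⟩
    rw [hGe.modelCov_eq hx] at hf
    exact CMSeq.isReciprocal_of_obeysCMModel_zero hx hGe hf
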